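/- Let $\pi=(\pi^{ij})$ be a smooth Poisson tensor on $M=\mathbb{R}^n$ (so $\{f,g\}=\pi^{ij}\partial_if\,\partial_jg$), let $H\in C^\infty(M)$ and $\epsilon\ge 0$. On $T^*M=\mathbb{R}^n\times\mathbb{R}^n$ with coordinates $(x^i,p_i)$, let $\overline V=-\pi^{ij}(x)p_i\,\partial_{x^j}$, let $\phi_\epsilon(y,p)=\frac1\epsilon\int_0^\epsilon y(s)\,ds$, where $(y(s),p)$ is the integral curve of $\overline V$ starting at $(y,p)$ (and $\phi_0(y,p)=y$), and let $\alpha_\epsilon:U\to M$ be the Karasev realization map: the smooth solution of \[ \phi_\epsilon(\alpha_\epsilon(x,p),p)=x,\qquad \alpha_\epsilon(x,0)=x, \] on an open neighbourhood $U$ of the zero section $0_M$ with $(x,p)\in U\Rightarrow(x,-p)\in U$. Let $c:\mathbb{R}\to\mathbb{R}$ satisfy $c(-h)=c(h)$ (equivalently, the additive normalization $\int_0^hc$ of the generating function is odd in $h$), and let $S_{\epsilon,h}(x)$ be a smooth function of $(h,x)$ on an open neighbourhood $W$ of $\{0\}\times M$ in $\mathbb{R}\times M$, with $(x,dS_{\epsilon,h}(x))\in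 U$, solving the Hamilton–Jacobi evolution equation \[ \partial_hS_{\epsilon,h}(x)=H\bigl(\alpha_\epsilon(x,dS_{\epsilon,h}(x))\bigr)+c(h),\qquad S_{\epsilon,0}=0 . \] Then $S_{\epsilon,h}$ is odd in $h$: 1. If $(-r,r)\times M\subset W$ and, for $|h|<r$, $S_{\epsilon,h}$ is the exact generating function, i.e. $\mathrm{graph}(dS_{\epsilon,h})$ is the image of $0_M$ under the time-$h$ Hamiltonian flow of $H\circ\alpha_\epsilon$ in $(U,\,dp_i\wedge dx^i)$ (taken at those points of $0_M$ where it is defined), then $S_{\epsilon,-h}=-S_{\epsilon,h}$ on $M$ for all $|h|<r$. 2. In any case there is an open set $W'\subset W$ containing $\{0\}\times M$ and invariant under $(h,x)\mapsto(-h,x)$ such that $S_{\epsilon,-h}(x)=-S_{\epsilon,h}(x)$ for all $(h,x)\in W'$. 3. In particular, the coefficients $S_{\epsilon,(l)}=\frac1{l!}\partial_h^lS_{\epsilon,h}|_{h=0}$ vanish for even $l$, so that for every $m$ the truncation $\hat S_{\epsilon,h}=\sum_{l=0}^mS_{\epsilon,(l)}h^l$ has only odd powers of $h$: $\hat S_{\epsilon,h}=\sum_{l\le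 m,\ l\ \mathrm{odd}}S_{\epsilon,(l)}h^l$. -/

import Mathlib

open Set
open scoped ContDiff Topology

noncomputable section

namespace Karasev

/-- The phase space `M = ℝⁿ`. A point of `T*M = ℝⁿ × ℝⁿ` is a pair `(x, p)`, where `p` lists the
canonical momentum coordinates `p i`. -/
abbrev Pt (n : ℕ) : Type := Fin n → ℝ

variable {n : ℕ}

/-- The partial derivative `∂f/∂xⁱ` at `x`. -/
def pderiv (i : Fin n) (f : Pt n → ℝ) (x : Pt n) : ℝ :=
  fderiv ℝ f x (Pi.single i 1)

/-- The coordinate expression `p i = ∂f/∂xⁱ` of the differential of `f` at `x`. -/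
def differential (f : Pt n → ℝ) (x : Pt n) : Pt n :=
  fun i => pderiv i f x

/-- The graph of the differential of `f`, as a subset of `T*M`. -/
def graphDifferential (f : Pt n → ℝ) : Set (Pt n × Pt n) :=
  {z | z.2 = differential f z.1}

/-- The bracket `{f, g} = πⁱʲ ∂ᵢf ∂ⱼg` of a bivector field with components `πⁱʲ = π(dxⁱ, dxʲ)`. -/
def bracket (π : Pt n → Matrix (Fin n) (Fin n) ℝ) (f g : Pt n → ℝ) (x : Pt n) : ℝ :=
  ∑ i, ∑ j, π x i j * pderiv i f x * pderiv j g x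

/-- Smooth Poisson tensors on `ℝⁿ`: the associated bracket on smooth functions is skew-symmetric
and satisfies the Jacobi identity (the Leibniz rule is automatic for a bivector field). -/
structure IsPoissonTensor (π : Pt n → Matrix (Fin n) (Fin n) ℝ) : Prop where
  smooth : ∀ i j, ContDiff ℝ ∞ fun x => π x i j
  skew : ∀ x i j, π x j i = -π x i j
  jacobi : ∀ f g k : Pt n → ℝ, ContDiff ℝ ∞ f → ContDiff ℝ ∞ g → ContDiff ℝ ∞ k → ∀ x,
    bracket π (bracket π f g) k x + bracket π (bracket π k f) g x
      + bracket π (bracket π g k) f x = 0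

/-- The flat Poisson spray `-πⁱʲ(x) pᵢ ∂/∂xʲ` on `T*M`; the momenta do not evolve. -/
def spray (π : Pt n → Matrix (Fin n) (Fin n) ℝ) (z : Pt n × Pt n) : Pt n × Pt n :=
  (fun j => -∑ i, π z.1 i j * z.2 i, 0)

/-- The average over `[0, ε]` of the `x`-component of a curve in `T*M`
(for `ε = 0`: its value at time `0`). -/
def xAverage (ε : ℝ) (γ : ℝ → Pt n × Pt n) : Pt n :=
  if ε = 0 then (γ 0).1 else ε⁻¹ • ∫ s in (0 : ℝ)..ε, (γ s).1

/-- `φ_ε(y, p) = x`, for the `x`-average map `φ_ε` of the flow of the flat Poisson spray: the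
integral curve of the spray that starts at `(y, p)` exists on `[0, ε]` and its `x`-component has
average `x`. -/
def SprayAverage (π : Pt n → Matrix (Fin n) (Fin n) ℝ) (ε : ℝ) (y p x : Pt n) : Prop :=
  ∃ γ : ℝ → Pt n × Pt n, γ 0 = (y, p) ∧ IsIntegralCurveOn γ (fun _ => spray π) (Icc 0 ε) ∧
    xAverage ε γ = x

/-- `α : U → M` is the Karasev realization map `α_ε` of `(ℝⁿ, ε π)` on the open neighbourhood `U`
of the zero section of `T*M`: the smooth solution of `φ_ε(α(x, p), p) = x` with `α(x, 0) = x`.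
The neighbourhood is symmetric, so that the dual map `β(x, p) = α(x, -p)` is defined on it too. -/
structure IsKarasevMap (π : Pt n → Matrix (Fin n) (Fin n) ℝ) (ε : ℝ) (U : Set (Pt n × Pt n))
    (α : Pt n × Pt n → Pt n) : Prop where
  isOpen : IsOpen U
  zero_mem : ∀ x, (x, 0) ∈ U
  neg_mem : ∀ x p, (x, p) ∈ U → (x, -p) ∈ U
  smooth : ContDiffOn ℝ ∞ α U
  map_zero : ∀ x, α (x, 0) = x
  implicit : ∀ x p, (x, p) ∈ U → SprayAverage π ε (α (x, p)) p x

/-- The Hamiltonian vector field `-∂G/∂pᵢ ∂/∂xⁱ + ∂G/∂xⁱ ∂/∂pᵢ` of `G` with respect to the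
symplectic form `dpᵢ ∧ dxⁱ`. -/
def hamiltonianField (G : Pt n × Pt n → ℝ) (z : Pt n × Pt n) : Pt n × Pt n :=
  (fun i => -fderiv ℝ G z (0, Pi.single i 1), fun i => fderiv ℝ G z (Pi.single i 1, 0))

/-- The image of the zero section under the time-`h` Hamiltonian flow of `G` inside `U`. -/
def flowOfZeroSection (U : Set (Pt n × Pt n)) (G : Pt n × Pt n → ℝ) (h : ℝ) :
    Set (Pt n × Pt n) :=
  {z | ∃ γ : ℝ → Pt n × Pt n, (γ 0).2 = 0 ∧ (∀ t ∈ uIcc 0 h, γ t ∈ U) ∧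
    IsIntegralCurveOn γ (fun _ => hamiltonianField G) (uIcc 0 h) ∧ γ h = z}

/-- `S h x`, for `(h, x)` in an open neighbourhood `W` of `{0} × M`, is a smooth solution of the
evolution equation `∂S/∂h (x) = G(x, dS_h(x)) + c(h)` with `S_0 = 0`. The values of `S` outside
of `W` play no role. -/
structure IsHJSolution (U : Set (Pt n × Pt n)) (G : Pt n × Pt n → ℝ) (c : ℝ → ℝ)
    (W : Set (ℝ × Pt n)) (S : ℝ → Pt n → ℝ) : Prop where
  isOpen : IsOpen W
  zero_mem : ∀ x, (0, x) ∈ W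
  smooth : ContDiffOn ℝ ∞ (fun q : ℝ × Pt n => S q.1 q.2) W
  initial : ∀ x, S 0 x = 0
  mem : ∀ h x, (h, x) ∈ W → (x, differential (S h) x) ∈ U
  eqn : ∀ h x, (h, x) ∈ W →
    HasDerivAt (fun t => S t x) (G (x, differential (S h) x) + c h) h

/-- The coefficient of `h ^ l` in the Taylor expansion of `S` around `h = 0`. -/
def coeff (S : ℝ → Pt n → ℝ) (l : ℕ) (x : Pt n) : ℝ :=
  iteratedDeriv l (fun t => S t x) 0 / (l.factorial : ℝ)

/-- The truncation of `S` up to order `m` in `h`. -/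
def truncation (S : ℝ → Pt n → ℝ) (m : ℕ) (h : ℝ) (x : Pt n) : ℝ :=
  ∑ l ∈ Finset.range (m + 1), coeff S l x * h ^ l

end Karasev

end

/-! Put `G = H ∘ α` and `β(x, p) = α(x, -p)`. The function `T_h = -S_{-h}` has the same initial
value as `S`, and since `c` is even it solves the same evolution equation as soon as `H ∘ α` and `H
∘ β` agree on the graphs of `dS_h`. Uniqueness then gives `T = S`. So the point is that `defect G =
G - G ∘ reflect` vanishes on these graphs. It vanishes on the zero section, and the graphs arise
from the zero section by the Hamiltonian flow of `G`; hence it is enough that `G` and `G ∘ reflect`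
Poisson commute.

This commutation is the geometric core. Running a spray trajectory backwards with the opposite
momentum gives a spray trajectory with the same average, so `β` should be the time-`ε` endpoint of
the trajectory that starts at `α`. The implicit equation has locally unique solutions, so this
identification holds on a set that contains the zero section and is both open and relatively closed
in `U` (`dualitySet`). On that set `IsVariation.endpoint_eq_zero` says that the endpoint does not
move along Hamiltonian vectors of functions of the starting point. Its proof pairs variations of the
trajectory with a solution `θ` of the adjoint linearized equation; the Jacobi identity enters
through `IsPoissonTensor.lieDerivative_eq_zero`, by which the Poisson tensor turns `θ` into a
variation. The case `ε = 0` is trivial, because `α` is then the projection.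

Uniqueness is used in two forms. For the exact generating function, the method of characteristics
(`IsHJSolution.eq_lift_of_isIntegralCurveOn`) shows that `S` and `T` have the same differential.
Near `h = 0`, where no flow is assumed to sweep out the graphs, Haar's inequality
(`eventually_eq_zero_of_haar`) is applied twice: to the defect along the lift of `S`, then to `S_h +
S_{-h}`. -/

noncomputable section

namespace Karasev

section

open Filter Metric

/-! ### Ordinary differential equations -/

section ODE

variable {E : Type*} [NormedAddCommGroup E] [NormedSpace ℝ E]

/-- Lets one constant `δ` serve as both initial error and defect and be factored out of the bound,
so that estimates become linear in `δ`. -/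
theorem gronwallBound_smul (c δ K η x : ℝ) :
    gronwallBound (c * δ) K (c * η) x = c * gronwallBound δ K η x := by
  unfold gronwallBound
  split_ifs <;> ring

theorem hasDerivWithinAt_Ici_of_Icc {f : ℝ → E} {f' : E} {a b t : ℝ} (ht : t ∈ Ico a b)
    (h : HasDerivWithinAt f f' (Icc a b) t) : HasDerivWithinAt f f' (Ici t) t :=
  h.mono_of_mem_nhdsWithin
    (mem_of_superset (Icc_mem_nhdsGE ht.2) (Icc_subset_Icc_left ht.1))

/-- A continuous cut-off of a vector of `ℝⁿ` to the cube `[-R, R]ⁿ`. -/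
def clip {n : ℕ} (R : ℝ) (x : Pt n) : Pt n := fun i => max (-R) (min R (x i))

theorem lipschitzWith_clip {n : ℕ} (R : ℝ) : LipschitzWith 1 (clip (n := n) R) := by
  refine LipschitzWith.of_dist_le_mul fun x y => ?_
  simp only [NNReal.coe_one, one_mul]
  refine (dist_pi_le_iff dist_nonneg).2 fun i => ?_
  have h1 : LipschitzWith 1 fun t : ℝ => max (-R) (min R t) :=
    (LipschitzWith.id.const_min R).const_max (-R)
  refine (h1.dist_le_mul (x i) (y i)).trans ?_
  simpa using dist_le_pi_dist x y i

theorem clip_eq {n : ℕ} {R : ℝ} {x : Pt n} (h : ‖x‖ ≤ R) : clip R x = x := by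
  funext i
  have h1 := abs_le.1 ((norm_le_pi_norm x i).trans h)
  simp [clip, h1.1, h1.2]

theorem norm_clip_le {n : ℕ} {R : ℝ} (hR : 0 ≤ R) (x : Pt n) : ‖clip R x‖ ≤ R := by
  refine (pi_norm_le_iff_of_nonneg hR).2 fun i => ?_
  simp only [clip, Real.norm_eq_abs]
  exact abs_le.2 ⟨le_max_left _ _, max_le (by linarith) (min_le_left _ _)⟩

theorem norm_clip_le_norm {n : ℕ} {R : ℝ} (hR : 0 ≤ R) (x : Pt n) : ‖clip R x‖ ≤ ‖x‖ := by
  have h := (lipschitzWith_clip (n := n) R).dist_le_mul x 0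
  rw [clip_eq (x := (0 : Pt n)) (by simpa using hR)] at h
  simpa using h

/-- Global solvability of affine differential equations with continuous coefficients. -/
theorem exists_affine_ode_solution {n : ℕ} {a b : ℝ} (hab : a ≤ b) {A : ℝ → Pt n →L[ℝ] Pt n}
    {g : ℝ → Pt n} (hA : ContinuousOn A (Icc a b)) (hg : ContinuousOn g (Icc a b)) (x₀ : Pt n) :
    ∃ ξ : ℝ → Pt n, ξ a = x₀ ∧
      ∀ s ∈ Icc a b, HasDerivWithinAt ξ (A s (ξ s) + g s) (Icc a b) s := by
  obtain ⟨K, hK⟩ := isCompact_Icc.exists_bound_of_continuousOn hA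
  obtain ⟨M, hM⟩ := isCompact_Icc.exists_bound_of_continuousOn hg
  have hK0 : 0 ≤ K := (norm_nonneg _).trans (hK a (left_mem_Icc.2 hab))
  have hM0 : 0 ≤ M := (norm_nonneg _).trans (hM a (left_mem_Icc.2 hab))
  -- `R` is the a priori bound for any solution. Clipping at `R` makes the field bounded and
  -- globally Lipschitz, so Picard–Lindelöf covers the whole interval at once.
  set R : ℝ := gronwallBound ‖x₀‖ K M (b - a) with hRdef
  have hba : 0 ≤ b - a := sub_nonneg.2 hab
  have hR : 0 ≤ R := by
    have := gronwallBound_mono (norm_nonneg x₀) hM0 hK0 hba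
    rw [gronwallBound_x0] at this
    exact (norm_nonneg _).trans this
  set f : ℝ → Pt n → Pt n := fun s x => A s (clip R x) + g s with hf
  have hPL : IsPicardLindelof f (⟨a, left_mem_Icc.2 hab⟩ : Icc a b) x₀
      ((K.toNNReal * R.toNNReal + M.toNNReal) * (b - a).toNNReal) 0
      (K.toNNReal * R.toNNReal + M.toNNReal) K.toNNReal := by
    refine ⟨fun t ht => ?_, fun x _ => ?_, fun t ht x _ => ?_, ?_⟩
    · refine LipschitzOnWith.of_dist_le_mul fun x _ y _ => ?_
      rw [Real.coe_toNNReal _ hK0]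
      simp only [hf, dist_add_right]
      rw [dist_eq_norm, ← map_sub]
      refine ((A t).le_opNorm _).trans (mul_le_mul (hK t ht) ?_ (norm_nonneg _) hK0)
      rw [← dist_eq_norm]
      simpa using (lipschitzWith_clip R).dist_le_mul x y
    · exact (hA.clm_apply continuousOn_const).add hg
    · simp only [NNReal.coe_add, NNReal.coe_mul, Real.coe_toNNReal _ hK0, Real.coe_toNNReal _ hR,
        Real.coe_toNNReal _ hM0]
      refine (norm_add_le _ _).trans (add_le_add ?_ (hM t ht))
      exact ((A t).le_opNorm _).trans (mul_le_mul (hK t ht) (norm_clip_le hR x)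
        (norm_nonneg _) hK0)
    · simp [Real.coe_toNNReal _ hba, max_eq_left hba]
  obtain ⟨ξ, hξ0, hξ⟩ := hPL.exists_eq_forall_mem_Icc_hasDerivWithinAt₀
  refine ⟨ξ, hξ0, fun s hs => ?_⟩
  have hcont : ContinuousOn ξ (Icc a b) := fun t ht => (hξ t ht).continuousWithinAt
  -- Clipping does not increase norms, so the clipped solution obeys the same a priori bound and the
  -- clipping is never active.
  have hbd := norm_le_gronwallBound_of_norm_deriv_right_le (f := ξ) (f' := fun t => f t (ξ t))
    (δ := ‖x₀‖) (K := K) (ε := M) hcont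
    (fun t ht => hasDerivWithinAt_Ici_of_Icc ht (hξ t (Ico_subset_Icc_self ht)))
    (by simp only at hξ0; rw [hξ0])
    (fun t ht => (norm_add_le _ _).trans (add_le_add
      (((A t).le_opNorm _).trans (mul_le_mul (hK t (Ico_subset_Icc_self ht))
        (norm_clip_le_norm hR _) (norm_nonneg _) hK0)) (hM t (Ico_subset_Icc_self ht)))) s hs
  have h1 := hξ s hs
  simp only [hf] at h1
  rwa [clip_eq] at h1
  exact hbd.trans (gronwallBound_mono (norm_nonneg _) hM0 hK0 (by linarith [hs.2]))

/-- Time reversal of the initial value problem; it provides the adjoint variable, which is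
prescribed at the final time. -/
theorem exists_affine_ode_solution_terminal {n : ℕ} {b : ℝ} (hb : 0 ≤ b)
    {A : ℝ → Pt n →L[ℝ] Pt n} {g : ℝ → Pt n} (hA : ContinuousOn A (Icc 0 b))
    (hg : ContinuousOn g (Icc 0 b)) (x₀ : Pt n) :
    ∃ ξ : ℝ → Pt n, ξ b = x₀ ∧
      ∀ s ∈ Icc 0 b, HasDerivWithinAt ξ (A s (ξ s) + g s) (Icc 0 b) s := by
  have hmap : MapsTo (fun s : ℝ => b - s) (Icc 0 b) (Icc 0 b) := fun s hs =>
    ⟨by linarith [hs.2], by linarith [hs.1]⟩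
  have hc : ContinuousOn (fun s : ℝ => b - s) (Icc 0 b) := by fun_prop
  obtain ⟨ξ, h0, h⟩ := exists_affine_ode_solution hb (A := fun s => -A (b - s))
    (g := fun s => -g (b - s)) (hA.comp hc hmap).neg (hg.comp hc hmap).neg x₀
  refine ⟨fun s => ξ (b - s), by simpa using h0, fun s hs => ?_⟩
  have h1 := (h (b - s) (hmap hs)).scomp s
    ((hasDerivAt_id s).const_sub b).hasDerivWithinAt hmap
  refine h1.congr_deriv ?_
  simp only [sub_sub_cancel, neg_apply, neg_smul, one_smul, neg_add_rev,
    neg_neg]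
  exact add_comm _ _

/-- An approximate trajectory `w` of `v` and a trajectory `γ` which starts near `w` stay close,
if `v` is Lipschitz on a tube around `w`. -/
theorem dist_le_of_lipschitz_tube {v : E → E} {K : NNReal} {w w' γ : ℝ → E} {a b δ ρ : ℝ}
    (hv : ∀ t ∈ Icc a b, LipschitzOnWith K v (closedBall (w t) ρ))
    (hw : ContinuousOn w (Icc a b))
    (hw' : ∀ t ∈ Ico a b, HasDerivWithinAt w (w' t) (Ici t) t)
    (hdef : ∀ t ∈ Ico a b, dist (w' t) (v (w t)) ≤ δ)
    (hγ : IsIntegralCurveOn γ (fun _ => v) (Icc a b))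
    (ha : dist (w a) (γ a) ≤ δ) (hδ : 0 ≤ δ)
    (hρ : δ * gronwallBound 1 K 1 (b - a) < ρ) :
    ∀ t ∈ Icc a b, dist (w t) (γ t) ≤ δ * gronwallBound 1 K 1 (b - a) := by
  have hmono : ∀ t ∈ Icc a b,
      δ * gronwallBound 1 K 1 (t - a) ≤ δ * gronwallBound 1 K 1 (b - a) := fun t ht =>
    mul_le_mul_of_nonneg_left (gronwallBound_mono zero_le_one zero_le_one K.2
      (by linarith [ht.2])) hδ
  -- Bootstrap: as long as `γ` stays in the tube of radius `ρ`, Gronwall gives a bound strictly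
  -- below `ρ`. The first time at which the distance reaches `ρ` then yields a contradiction.
  have key : ∀ c ∈ Icc a b, (∀ t ∈ Ico a c, dist (w t) (γ t) ≤ ρ) →
      ∀ t ∈ Icc a c, dist (w t) (γ t) ≤ δ * gronwallBound 1 K 1 (b - a) := by
    intro c hc hin t ht
    have hsub : Icc a c ⊆ Icc a b := Icc_subset_Icc_right hc.2
    have hsub' : Ico a c ⊆ Ico a b := Ico_subset_Ico_right hc.2
    have h1 := dist_le_of_approx_trajectories_ODE_of_mem (v := fun _ => v) (K := K)
      (s := fun t => closedBall (w t) ρ) (f := w) (g := γ) (f' := w') (g' := fun t => v (γ t))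
      (a := a) (b := c) (εf := δ) (εg := 0) (δ := δ)
      (fun t ht => hv t (hsub (Ico_subset_Icc_self ht))) (hw.mono hsub)
      (fun t ht => hw' t (hsub' ht)) (fun t ht => hdef t (hsub' ht))
      (fun t ht => mem_closedBall_self (dist_nonneg.trans (hin t ht)))
      (hγ.continuousOn.mono hsub)
      (fun t ht => hasDerivWithinAt_Ici_of_Icc (hsub' ht) (hγ t (hsub (Ico_subset_Icc_self ht))))
      (fun t _ => by simp) (fun t ht => by rw [mem_closedBall, dist_comm]; exact hin t ht) ha t ht
    have h2 := gronwallBound_smul δ 1 K 1 (t - a)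
    simp only [mul_one] at h2
    rw [add_zero, h2] at h1
    exact h1.trans (hmono t (hsub ht))
  by_contra! hcon
  obtain ⟨t₀, ht₀, hlt⟩ := hcon
  have hbad : ¬ ∀ t ∈ Ico a b, dist (w t) (γ t) ≤ ρ := fun h =>
    absurd (key b ⟨ht₀.1.trans ht₀.2, le_rfl⟩ h t₀ ht₀) (not_le.2 hlt)
  push Not at hbad
  obtain ⟨t₁, ht₁, hlt₁⟩ := hbad
  have hdc : ContinuousOn (fun t => dist (w t) (γ t)) (Icc a b) := 
    continuous_dist.comp_continuousOn (hw.prodMk hγ.continuousOn)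
  have hcomp : IsCompact (Icc a b ∩ (fun t => dist (w t) (γ t)) ⁻¹' Ici ρ) :=
    isCompact_Icc.of_isClosed_subset (hdc.preimage_isClosed_of_isClosed isClosed_Icc isClosed_Ici)
      inter_subset_left
  obtain ⟨c, hc, hmin⟩ := hcomp.exists_isLeast ⟨t₁, Ico_subset_Icc_self ht₁, hlt₁.le⟩
  have h1 := key c hc.1 (fun t ht => by
    by_contra! h
    exact absurd (hmin ⟨⟨ht.1, ht.2.le.trans hc.1.2⟩, h.le⟩) (not_le.2 ht.2)) c
    ⟨hc.1.1, le_rfl⟩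
  exact absurd (hc.2.trans h1) (not_le.2 hρ)

variable [FiniteDimensional ℝ E]

theorem exists_lipschitzOnWith_closedBall {F : Type*} [NormedAddCommGroup F] [NormedSpace ℝ F]
    {f : E → F} (hf : ContDiff ℝ 1 f) (R : ℝ) :
    ∃ K : NNReal, LipschitzOnWith K f (closedBall 0 R) := by
  have := FiniteDimensional.proper ℝ E
  obtain ⟨K, hK⟩ := (isCompact_closedBall (0 : E) R).exists_bound_of_continuousOn
    (hf.continuous_fderiv one_ne_zero).continuousOn
  refine ⟨K.toNNReal, (convex_closedBall (0 : E) R).lipschitzOnWith_of_nnnorm_fderiv_le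
    (fun x _ => hf.differentiable one_ne_zero x) fun x hx => ?_⟩
  rw [← NNReal.coe_le_coe, coe_nnnorm]
  exact (hK x hx).trans (Real.le_coe_toNNReal K)

/-- Trajectories depend continuously on their initial point, as long as they exist. -/
theorem tendsto_of_isIntegralCurveOn {ι : Type*} {l : Filter ι} {v : E → E} (hv : ContDiff ℝ 1 v)
    {a b : ℝ} {γ : ι → ℝ → E} {γ₀ : ℝ → E}
    (hγ : ∀ᶠ i in l, IsIntegralCurveOn (γ i) (fun _ => v) (Icc a b))
    (hγ₀ : IsIntegralCurveOn γ₀ (fun _ => v) (Icc a b))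
    (ha : Tendsto (fun i => γ i a) l (𝓝 (γ₀ a))) {t : ℝ} (ht : t ∈ Icc a b) :
    Tendsto (fun i => γ i t) l (𝓝 (γ₀ t)) := by
  obtain ⟨R, hR⟩ := isCompact_Icc.exists_bound_of_continuousOn hγ₀.continuousOn
  obtain ⟨K, hK⟩ := exists_lipschitzOnWith_closedBall hv (R + 1)
  set C := gronwallBound 1 K 1 (b - a)
  have hC : 0 ≤ C := by
    have := gronwallBound_mono zero_le_one zero_le_one K.2 (sub_nonneg.2 (ht.1.trans ht.2))
    rw [gronwallBound_x0] at this
    exact zero_le_one.trans this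
  rw [Metric.tendsto_nhds]
  intro e he
  set δ := min e 1 / (C + 1)
  have hδ : 0 < δ := by positivity
  have hδC : δ * C < min e 1 := by
    have : δ * (C + 1) = min e 1 := div_mul_cancel₀ _ (by positivity)
    nlinarith
  filter_upwards [hγ, Metric.tendsto_nhds.1 ha δ hδ] with i hi hd
  have h := dist_le_of_lipschitz_tube (w := γ₀) (w' := fun t => v (γ₀ t)) (γ := γ i) (ρ := 1)
    (δ := δ) (fun s hs => hK.mono fun y hy => by
      rw [mem_closedBall_zero_iff]
      rw [mem_closedBall, dist_eq_norm, norm_sub_rev] at hy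
      have := norm_le_norm_add_norm_sub (γ₀ s) y
      linarith [hR s hs]) hγ₀.continuousOn
    (fun s hs => hasDerivWithinAt_Ici_of_Icc hs (hγ₀ s (Ico_subset_Icc_self hs)))
    (fun s _ => by simpa using hδ.le) hi (by rw [dist_comm]; exact hd.le) hδ.le
    (hδC.trans_le (min_le_right _ _)) t ht
  rw [dist_comm]
  exact h.trans_lt (hδC.trans_le (min_le_left _ _))

/-- Uniqueness is continuous dependence applied to a constant family: the limit of a constant is
that constant. -/
theorem eqOn_of_isIntegralCurveOn {v : E → E} (hv : ContDiff ℝ 1 v) {a b : ℝ} {γ₁ γ₂ : ℝ → E}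
    (h₁ : IsIntegralCurveOn γ₁ (fun _ => v) (Icc a b))
    (h₂ : IsIntegralCurveOn γ₂ (fun _ => v) (Icc a b)) (ha : γ₁ a = γ₂ a) :
    EqOn γ₁ γ₂ (Icc a b) := fun t ht => by
  have h := tendsto_of_isIntegralCurveOn (ι := Unit) (l := ⊤) (γ := fun _ => γ₁) hv (by simp [h₁])
    h₂ (by rw [ha]; exact tendsto_const_nhds) ht
  exact tendsto_nhds_unique tendsto_const_nhds h

/-- The first variation of a family of trajectories solves the linearized equation. -/
theorem isLittleO_first_variation {v : E → E} (hv : ContDiff ℝ 2 v) {b : ℝ}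
    {γ : ℝ → ℝ → E} {Ξ : ℝ → E} (hb : 0 ≤ b)
    (hγ : ∀ᶠ τ in 𝓝 (0 : ℝ), IsIntegralCurveOn (γ τ) (fun _ => v) (Icc 0 b))
    (hΞ : ∀ s ∈ Icc 0 b, HasDerivWithinAt Ξ (fderiv ℝ v (γ 0 s) (Ξ s)) (Icc 0 b) s)
    (h0 : HasDerivAt (fun τ => γ τ 0) (Ξ 0) 0) {e : ℝ} (he : 0 < e) :
    ∀ᶠ τ in 𝓝 (0 : ℝ), ∀ s ∈ Icc 0 b, ‖γ τ s - γ 0 s - τ • Ξ s‖ ≤ e * |τ| := by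
  have hγ₀ : IsIntegralCurveOn (γ 0) (fun _ => v) (Icc 0 b) := hγ.self_of_nhds
  have hΞc : ContinuousOn Ξ (Icc 0 b) := fun s hs => (hΞ s hs).continuousWithinAt
  obtain ⟨R, hR⟩ := isCompact_Icc.exists_bound_of_continuousOn hγ₀.continuousOn
  obtain ⟨N, hN⟩ := isCompact_Icc.exists_bound_of_continuousOn hΞc
  have hN0 : 0 ≤ N := (norm_nonneg _).trans (hN 0 (left_mem_Icc.2 hb))
  -- One unit of room is for the shift `τ • Ξ s`, the other for the tube of radius `1` around the
  -- shifted curve.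
  obtain ⟨K, hK⟩ := exists_lipschitzOnWith_closedBall (hv.of_le one_le_two) (R + 2)
  obtain ⟨M, hM⟩ := exists_lipschitzOnWith_closedBall
    (hv.fderiv_right (m := 1) (by norm_num)) (R + 2)
  set C := gronwallBound 1 K 1 (b - 0)
  have hC : 0 ≤ C := by
    have := gronwallBound_mono zero_le_one zero_le_one K.2 (sub_nonneg.2 hb)
    rw [gronwallBound_x0] at this
    exact zero_le_one.trans this
  set d := e / (C + 1)
  have hd : 0 < d := by positivity
  have hdC : d * C ≤ e := by
    have : d * (C + 1) = e := div_mul_cancel₀ _ (by positivity)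
    nlinarith
  have hlim : ∀ c : ℝ, ∀ r > 0, ∀ᶠ τ in 𝓝 (0 : ℝ), |τ| * c < r := fun c r hr => by
    have : Tendsto (fun τ : ℝ => |τ| * c) (𝓝 0) (𝓝 (|0| * c)) := by
      apply Continuous.tendsto; fun_prop
    rw [abs_zero, zero_mul] at this
    exact this.eventually_lt_const hr
  have hini : ∀ᶠ τ in 𝓝 (0 : ℝ), ‖γ τ 0 - γ 0 0 - τ • Ξ 0‖ ≤ d * |τ| := by
    have := (hasDerivAt_iff_isLittleO.1 h0).def hd
    simpa using this
  filter_upwards [hγ, hini, hlim N 1 one_pos, hlim (M * N * N) d hd, hlim e 1 one_pos] with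
    τ h1 h2 h3 h4 h5 s hs
  have hnear : ∀ s ∈ Icc 0 b, ‖τ • Ξ s‖ ≤ |τ| * N := fun s hs => by
    rw [norm_smul, Real.norm_eq_abs]
    exact mul_le_mul_of_nonneg_left (hN s hs) (abs_nonneg _)
  -- The curve `γ 0 + τ • Ξ` solves the equation up to a defect quadratic in `τ`, by the mean value
  -- inequality with `fderiv ℝ v` Lipschitz; for small `τ` this is below `d * |τ|`.
  have hdef : ∀ s ∈ Icc 0 b,
      ‖v (γ 0 s + τ • Ξ s) - v (γ 0 s) - τ • fderiv ℝ v (γ 0 s) (Ξ s)‖ ≤ d * |τ| := by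
    intro s hs
    have hball : closedBall (γ 0 s) (|τ| * N) ⊆ closedBall 0 (R + 2) := fun y hy => by
      rw [mem_closedBall_zero_iff]
      rw [mem_closedBall, dist_eq_norm, norm_sub_rev] at hy
      have := norm_le_norm_add_norm_sub (γ 0 s) y
      linarith [hR s hs]
    have hself : γ 0 s ∈ closedBall (γ 0 s) (|τ| * N) :=
      mem_closedBall_self (by positivity)
    have h6 := (convex_closedBall (γ 0 s) (|τ| * N)).norm_image_sub_le_of_norm_fderiv_le'
      (𝕜 := ℝ) (f := v) (φ := fderiv ℝ v (γ 0 s)) (C := M * (|τ| * N)) (x := γ 0 s)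
      (y := γ 0 s + τ • Ξ s)
      (fun x _ => hv.differentiable two_ne_zero x) (fun x hx => by
        rw [← dist_eq_norm]
        exact (hM.dist_le_mul x (hball hx) _ (hball hself)).trans
          (mul_le_mul_of_nonneg_left hx M.2)) hself
      (by rw [mem_closedBall, dist_eq_norm, add_sub_cancel_left]; exact hnear s hs)
    rw [add_sub_cancel_left, map_smul] at h6
    refine h6.trans ?_
    calc M * (|τ| * N) * ‖τ • Ξ s‖ ≤ M * (|τ| * N) * (|τ| * N) :=
          mul_le_mul_of_nonneg_left (hnear s hs) (by positivity)
      _ = (|τ| * (M * N * N)) * |τ| := by ring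
      _ ≤ d * |τ| := mul_le_mul_of_nonneg_right h4.le (abs_nonneg _)
  have hw : ∀ s ∈ Icc 0 b, HasDerivWithinAt (fun s => γ 0 s + τ • Ξ s)
      (v (γ 0 s) + τ • fderiv ℝ v (γ 0 s) (Ξ s)) (Icc 0 b) s := fun s hs =>
    (hγ₀ s hs).add ((hΞ s hs).const_smul τ)
  have hfin := dist_le_of_lipschitz_tube (v := v) (K := K) (w := fun s => γ 0 s + τ • Ξ s)
    (w' := fun s => v (γ 0 s) + τ • fderiv ℝ v (γ 0 s) (Ξ s)) (γ := γ τ) (a := 0) (b := b)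
    (δ := d * |τ|) (ρ := 1)
    (fun s hs => hK.mono fun y hy => by
      rw [mem_closedBall_zero_iff]
      rw [mem_closedBall, dist_eq_norm, norm_sub_rev] at hy
      have h7 := norm_le_norm_add_norm_sub (γ 0 s + τ • Ξ s) y
      have h8 := norm_add_le (γ 0 s) (τ • Ξ s)
      linarith [hR s hs, hnear s hs])
    (fun s hs => (hw s hs).continuousWithinAt)
    (fun s hs => hasDerivWithinAt_Ici_of_Icc hs (hw s (Ico_subset_Icc_self hs)))
    (fun s hs => by
      rw [dist_comm, dist_eq_norm, ← sub_sub]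
      exact hdef s (Ico_subset_Icc_self hs)) h1
    (by rw [dist_comm, dist_eq_norm, ← sub_sub]; exact h2) (by positivity)
    (by nlinarith [abs_nonneg τ]) s hs
  rw [dist_comm, dist_eq_norm, ← sub_sub] at hfin
  refine hfin.trans ?_
  nlinarith [abs_nonneg τ]

end ODE

end

section

open Filter Metric Matrix

/-! ### The linearized Poisson spray -/

section Spray

variable {n : ℕ} {π : Pt n → Matrix (Fin n) (Fin n) ℝ}

/-- The matrix of the linearization in `x` of the spray at the point `(y, p)`. -/
def sprayMatrix (π : Pt n → Matrix (Fin n) (Fin n) ℝ) (y p : Pt n) : Matrix (Fin n) (Fin n) ℝ :=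
  Matrix.of fun j l => ∑ i, pderiv l (fun x => π x j i) y * p i

theorem spray_eq (hπ : IsPoissonTensor π) (z : Pt n × Pt n) : spray π z = (π z.1 *ᵥ z.2, 0) := by
  ext j
  · simp only [spray, mulVec, dotProduct, ← Finset.sum_neg_distrib]
    exact Finset.sum_congr rfl fun i _ => by rw [hπ.skew z.1 i j]; ring
  · rfl

theorem fderiv_apply_eq_sum_pderiv (f : Pt n → ℝ) (x v : Pt n) :
    fderiv ℝ f x v = ∑ i, v i * pderiv i f x := by
  conv_lhs => rw [pi_eq_sum_univ' v]
  simp [map_sum, pderiv]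

theorem contDiff_spray (hπ : IsPoissonTensor π) : ContDiff ℝ ∞ (spray π) := by
  refine ContDiff.prodMk (contDiff_pi.2 fun j => ContDiff.neg (ContDiff.sum fun i _ => ?_))
    contDiff_const
  exact ((hπ.smooth i j).comp contDiff_fst).mul ((contDiff_apply ℝ ℝ i).comp contDiff_snd)

theorem hasFDerivAt_entry (hπ : IsPoissonTensor π) (i j : Fin n) (y : Pt n) :
    HasFDerivAt (fun x => π x i j) (fderiv ℝ (fun x => π x i j) y) y :=
  ((hπ.smooth i j).differentiable (by simp) y).hasFDerivAt

/-- The spray is linear in the momentum, which contributes `π y *ᵥ q`; the dependence on the base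
point contributes `sprayMatrix`. The derivative is read off along a line. -/
theorem fderiv_spray (hπ : IsPoissonTensor π) (y p η q : Pt n) :
    fderiv ℝ (spray π) (y, p) (η, q) = (sprayMatrix π y p *ᵥ η + π y *ᵥ q, 0) := by
  have h1 : HasFDerivAt (spray π) (fderiv ℝ (spray π) (y, p)) (y, p) :=
    ((contDiff_spray hπ).differentiable (by simp) _).hasFDerivAt
  have hline : HasDerivAt (fun τ : ℝ => (y + τ • η, p + τ • q)) (η, q) 0 := by
    have a : HasDerivAt (fun τ : ℝ => y + τ • η) η 0 := by
      simpa using ((hasDerivAt_id (0 : ℝ)).smul_const η).const_add y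
    have b : HasDerivAt (fun τ : ℝ => p + τ • q) q 0 := by
      simpa using ((hasDerivAt_id (0 : ℝ)).smul_const q).const_add p
    exact a.prodMk b
  have h2 : HasDerivAt (fun τ : ℝ => spray π (y + τ • η, p + τ • q))
      (fderiv ℝ (spray π) (y, p) (η, q)) 0 :=
    HasFDerivAt.comp_hasDerivAt_of_eq (0 : ℝ) h1 hline (by simp)
  refine h2.unique ?_
  simp only [spray_eq hπ]
  refine HasDerivAt.prodMk (hasDerivAt_pi.2 fun j => ?_) (hasDerivAt_const _ _)
  have h3 : ∀ i, HasDerivAt (fun τ : ℝ => π (y + τ • η) j i * (p + τ • q) i)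
      ((∑ l, η l * pderiv l (fun x => π x j i) y) * p i + π y j i * q i) 0 := fun i => by
    have e1 : HasDerivAt (fun τ : ℝ => π (y + τ • η) j i)
        (∑ l, η l * pderiv l (fun x => π x j i) y) 0 := by
      rw [← fderiv_apply_eq_sum_pderiv]
      have a : HasDerivAt (fun τ : ℝ => y + τ • η) η 0 := by
        simpa using ((hasDerivAt_id (0 : ℝ)).smul_const η).const_add y
      exact HasFDerivAt.comp_hasDerivAt_of_eq (0 : ℝ) (hasFDerivAt_entry hπ j i y) a (by simp)
    have e2 : HasDerivAt (fun τ : ℝ => (p + τ • q) i) (q i) 0 := by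
      simpa using ((hasDerivAt_id (0 : ℝ)).mul_const (q i)).const_add (p i)
    simpa using e1.fun_mul e2
  have h4 := HasDerivAt.fun_sum (u := Finset.univ) fun i _ => h3 i
  refine h4.congr_deriv ?_
  simp only [Pi.add_apply, mulVec, dotProduct, sprayMatrix, of_apply, Finset.sum_add_distrib,
    Finset.sum_mul]
  rw [Finset.sum_comm]
  congr 1
  exact Finset.sum_congr rfl fun l _ => Finset.sum_congr rfl fun i _ => by ring

theorem contDiff_coord (i : Fin n) : ContDiff ℝ ∞ fun x : Pt n => x i := contDiff_apply ℝ ℝ i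

theorem pderiv_coord (i j : Fin n) (x : Pt n) :
    pderiv i (fun x : Pt n => x j) x = if i = j then 1 else 0 := by
  have : HasFDerivAt (fun x : Pt n => x j) (ContinuousLinearMap.proj (R := ℝ) j) x :=
    (ContinuousLinearMap.proj (R := ℝ) (φ := fun _ : Fin n => ℝ) j).hasFDerivAt
  rw [pderiv, this.fderiv]
  simp [Pi.single_apply, eq_comm]

/-- The Jacobi identity in coordinates. -/
theorem IsPoissonTensor.jacobi_coord (hπ : IsPoissonTensor π) (a b k : Fin n) (x : Pt n) :
    ∑ l, pderiv l (fun y => π y a b) x * π x l k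
      = ∑ l, pderiv l (fun y => π y a k) x * π x l b
        - ∑ l, pderiv l (fun y => π y b k) x * π x l a := by
  -- On coordinate functions the bracket returns the components of the tensor, so the Jacobi
  -- identity for three coordinates is the identity sought, up to skew symmetry.
  have hb : ∀ i j : Fin n, bracket π (fun x => x i) (fun x => x j) = fun x => π x i j := by
    intro i j
    funext y
    simp [bracket, pderiv_coord]
  have hc : ∀ (f : Pt n → ℝ) (k : Fin n), bracket π f (fun x => x k) x
      = ∑ l, pderiv l f x * π x l k := by
    intro f k
    simp [bracket, pderiv_coord, mul_comm]
  have h := hπ.jacobi _ _ _ (contDiff_coord a) (contDiff_coord b) (contDiff_coord k) x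
  rw [hb, hb, hb, hc, hc, hc] at h
  have hs : ∀ l, pderiv l (fun y => π y k a) x = -pderiv l (fun y => π y a k) x := by
    intro l
    have : (fun y => π y k a) = fun y => -π y a k := funext fun y => hπ.skew y a k
    rw [this, pderiv, pderiv, fderiv_fun_neg]
    rfl
  simp only [hs, neg_mul, Finset.sum_neg_distrib] at h
  linarith

/-- The spray preserves the Poisson tensor. -/
theorem IsPoissonTensor.lieDerivative_eq_zero (hπ : IsPoissonTensor π) (y p θ : Pt n) (a : Fin n) :
    ∑ b, fderiv ℝ (fun x => π x a b) y (π y *ᵥ p) * θ b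
      = (sprayMatrix π y p *ᵥ (π y *ᵥ θ) + π y *ᵥ ((sprayMatrix π y p)ᵀ *ᵥ θ)) a := by
  -- The Jacobi identity splits the derivative of the tensor along the spray into two sums; they
  -- match the two terms on the right, the second after one use of skew symmetry.
  have h1 : ∀ b, fderiv ℝ (fun x => π x a b) y (π y *ᵥ p)
      = ∑ k, (∑ l, pderiv l (fun y => π y a k) y * π y l b
        - ∑ l, pderiv l (fun y => π y b k) y * π y l a) * p k := by
    intro b
    rw [fderiv_apply_eq_sum_pderiv]
    simp only [← hπ.jacobi_coord, mulVec, dotProduct, Finset.sum_mul]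
    rw [Finset.sum_comm]
    exact Finset.sum_congr rfl fun l _ => Finset.sum_congr rfl fun i _ => by ring
  simp only [h1, Pi.add_apply, mulVec, dotProduct, sprayMatrix, of_apply, transpose_apply,
    Finset.sum_mul, Finset.mul_sum, sub_mul, Finset.sum_sub_distrib]
  rw [sub_eq_add_neg]
  congr 1
  · rw [Finset.sum_comm, Finset.sum_congr rfl fun k _ => Finset.sum_comm]
    rw [Finset.sum_comm]
    refine Finset.sum_congr rfl fun l _ => ?_
    rw [Finset.sum_comm]
    exact Finset.sum_congr rfl fun b _ => Finset.sum_congr rfl fun k _ => by ring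
  · rw [← Finset.sum_neg_distrib]
    conv_rhs => rw [Finset.sum_comm]
    refine Finset.sum_congr rfl fun b _ => ?_
    rw [Finset.sum_comm, ← Finset.sum_neg_distrib]
    refine Finset.sum_congr rfl fun l _ => ?_
    rw [← Finset.sum_neg_distrib]
    exact Finset.sum_congr rfl fun k _ => by rw [hπ.skew y a l]; ring

end Spray

end

section

open Filter Metric Matrix

/-! ### Variations of the curves that define the realization map -/

section LinearEquations

variable {n : ℕ}

theorem continuous_mulVecCLM : Continuous fun A : Matrix (Fin n) (Fin n) ℝ =>
    LinearMap.toContinuousLinearMap (Matrix.toLin' A) :=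
  ((LinearMap.toContinuousLinearMap (𝕜 := ℝ) (E := Pt n) (F' := Pt n)).toLinearMap ∘ₗ
    (Matrix.toLin' (R := ℝ) (m := Fin n) (n := Fin n)).toLinearMap).continuous_of_finiteDimensional

/-- The linear form `x ↦ w ⬝ᵥ x`. -/
def dotCLM (w : Pt n) : Pt n →L[ℝ] ℝ := ∑ i, w i • ContinuousLinearMap.proj i

theorem dotCLM_apply (w x : Pt n) : dotCLM w x = w ⬝ᵥ x := by
  simp [dotCLM, dotProduct]

theorem hasDerivWithinAt_dotProduct {f g : ℝ → Pt n} {f' g' : Pt n} {s : Set ℝ} {t : ℝ}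
    (hf : HasDerivWithinAt f f' s t) (hg : HasDerivWithinAt g g' s t) :
    HasDerivWithinAt (fun t => f t ⬝ᵥ g t) (f' ⬝ᵥ g t + f t ⬝ᵥ g') s t := by
  simp only [dotProduct, ← Finset.sum_add_distrib]
  exact HasDerivWithinAt.fun_sum fun i _ =>
    (hasDerivWithinAt_pi.1 hf i).fun_mul (hasDerivWithinAt_pi.1 hg i)

theorem eqOn_of_linear_ode {A : ℝ → Matrix (Fin n) (Fin n) ℝ} {g : ℝ → Pt n} {b : ℝ}
    (hA : ContinuousOn A (Icc 0 b)) {ξ η : ℝ → Pt n}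
    (hξ : ∀ s ∈ Icc 0 b, HasDerivWithinAt ξ (A s *ᵥ ξ s + g s) (Icc 0 b) s)
    (hη : ∀ s ∈ Icc 0 b, HasDerivWithinAt η (A s *ᵥ η s + g s) (Icc 0 b) s)
    (h0 : ξ 0 = η 0) : EqOn ξ η (Icc 0 b) := by
  obtain ⟨K, hK⟩ := isCompact_Icc.exists_bound_of_continuousOn
    (continuous_mulVecCLM.comp_continuousOn hA)
  have hd : ∀ s ∈ Icc 0 b,
      HasDerivWithinAt (fun s => ξ s - η s) (A s *ᵥ (ξ s - η s)) (Icc 0 b) s := fun s hs => by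
    refine ((hξ s hs).fun_sub (hη s hs)).congr_deriv ?_
    rw [mulVec_sub]; abel
  intro s hs
  refine sub_eq_zero.1 (eq_zero_of_abs_deriv_le_mul_abs_self_of_eq_zero_right (K := K)
    (fun s hs => (hd s hs).continuousWithinAt)
    (fun s hs => hasDerivWithinAt_Ici_of_Icc hs (hd s (Ico_subset_Icc_self hs)))
    (sub_eq_zero.2 h0) (fun s hs => ?_) s hs)
  refine (ContinuousLinearMap.le_opNorm (LinearMap.toContinuousLinearMap (Matrix.toLin' (A s)))
    (ξ s - η s)).trans ?_
  exact mul_le_mul_of_nonneg_right (hK s (Ico_subset_Icc_self hs)) (norm_nonneg _)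

end LinearEquations

variable {n : ℕ} {π : Pt n → Matrix (Fin n) (Fin n) ℝ} {ε : ℝ} {U : Set (Pt n × Pt n)}
  {α : Pt n × Pt n → Pt n} {Γ : Pt n × Pt n → ℝ → Pt n × Pt n}

/-- A choice of the spray trajectories whose averages define the realization map `α`. -/
structure IsSprayFamily (π : Pt n → Matrix (Fin n) (Fin n) ℝ) (ε : ℝ) (U : Set (Pt n × Pt n))
    (α : Pt n × Pt n → Pt n) (Γ : Pt n × Pt n → ℝ → Pt n × Pt n) : Prop where
  start : ∀ z ∈ U, Γ z 0 = (α z, z.2)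
  curve : ∀ z ∈ U, IsIntegralCurveOn (Γ z) (fun _ => spray π) (Icc 0 ε)
  average : ∀ z ∈ U, xAverage ε (Γ z) = z.1

theorem IsKarasevMap.exists_isSprayFamily (hα : IsKarasevMap π ε U α) :
    ∃ Γ, IsSprayFamily π ε U α Γ := by
  have h : ∀ z, ∃ γ : ℝ → Pt n × Pt n, z ∈ U → γ 0 = (α z, z.2) ∧
      IsIntegralCurveOn γ (fun _ => spray π) (Icc 0 ε) ∧ xAverage ε γ = z.1 := fun z => by
    by_cases hz : z ∈ U
    · obtain ⟨γ, h⟩ := hα.implicit z.1 z.2 hz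
      exact ⟨γ, fun _ => h⟩
    · exact ⟨0, fun h => absurd h hz⟩
  choose Γ hΓ using h
  exact ⟨Γ, fun z hz => (hΓ z hz).1, fun z hz => (hΓ z hz).2.1, fun z hz => (hΓ z hz).2.2⟩

theorem integral_eq_of_xAverage (hε : 0 < ε) {γ : ℝ → Pt n × Pt n} {x : Pt n}
    (h : xAverage ε γ = x) : ∫ s in (0 : ℝ)..ε, (γ s).1 = ε • x := by
  rw [xAverage, if_neg hε.ne'] at h
  rw [← h, smul_smul, mul_inv_cancel₀ hε.ne', one_smul]

theorem snd_eq_of_isIntegralCurveOn_spray {γ : ℝ → Pt n × Pt n}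
    (h : IsIntegralCurveOn γ (fun _ => spray π) (Icc 0 ε)) {s : ℝ} (hs : s ∈ Icc 0 ε) :
    (γ s).2 = (γ 0).2 :=
  constant_of_has_deriv_right_zero (f := fun s => (γ s).2)
    (continuous_snd.comp_continuousOn h.continuousOn)
    (fun t ht => (hasDerivWithinAt_Ici_of_Icc ht (h t (Ico_subset_Icc_self ht))).snd) s hs

theorem IsSprayFamily.snd_eq (hΓ : IsSprayFamily π ε U α Γ) {z : Pt n × Pt n} (hz : z ∈ U)
    {s : ℝ} (hs : s ∈ Icc 0 ε) : (Γ z s).2 = z.2 := by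
  rw [snd_eq_of_isIntegralCurveOn_spray (hΓ.curve z hz) hs, hΓ.start z hz]

theorem continuous_sprayMatrix (hπ : IsPoissonTensor π) (p : Pt n) :
    Continuous fun y => sprayMatrix π y p := by
  refine continuous_matrix fun j l => ?_
  simp only [sprayMatrix, of_apply, pderiv]
  refine continuous_finsetSum _ fun i _ => Continuous.mul ?_ continuous_const
  exact ((hπ.smooth j i).continuous_fderiv (by simp)).clm_apply continuous_const

theorem continuous_tensor (hπ : IsPoissonTensor π) : Continuous π :=
  continuous_matrix fun i j => (hπ.smooth i j).continuous

theorem IsSprayFamily.continuousOn_fst (hΓ : IsSprayFamily π ε U α Γ) {z : Pt n × Pt n}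
    (hz : z ∈ U) : ContinuousOn (fun s => (Γ z s).1) (Icc 0 ε) :=
  continuous_fst.comp_continuousOn (hΓ.curve z hz).continuousOn

/-- `ξ` is the first variation, in the direction `Y`, of the base curves of the family `Γ`. -/
structure IsVariation (π : Pt n → Matrix (Fin n) (Fin n) ℝ) (ε : ℝ)
    (α : Pt n × Pt n → Pt n) (Γ : Pt n × Pt n → ℝ → Pt n × Pt n) (z Y : Pt n × Pt n)
    (ξ : ℝ → Pt n) : Prop where
  start : ξ 0 = fderiv ℝ α z Y
  deriv : ∀ s ∈ Icc 0 ε, HasDerivWithinAt ξ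
    (sprayMatrix π (Γ z s).1 z.2 *ᵥ ξ s + π (Γ z s).1 *ᵥ Y.2) (Icc 0 ε) s
  integral : ∫ s in (0 : ℝ)..ε, ξ s = ε • Y.1
  endpoint : HasDerivAt (fun τ : ℝ => (Γ (z + τ • Y) ε).1) (ξ ε) 0

theorem hasDerivAt_line (z Y : Pt n × Pt n) : HasDerivAt (fun τ : ℝ => z + τ • Y) Y 0 := by
  simpa using ((hasDerivAt_id (0 : ℝ)).smul_const Y).const_add z

theorem IsKarasevMap.hasFDerivAt (hα : IsKarasevMap π ε U α) {z : Pt n × Pt n} (hz : z ∈ U) :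
    HasFDerivAt α (fderiv ℝ α z) z :=
  ((hα.smooth.contDiffAt (hα.isOpen.mem_nhds hz)).differentiableAt (by simp)).hasFDerivAt

/-- The linearized equation is solved with initial velocity `dα(Y)`. The first variation estimate is
uniform in `s`, so it may be integrated to differentiate the averaging constraint, and evaluated at
`ε` to differentiate the endpoint. -/
theorem exists_isVariation (hπ : IsPoissonTensor π) (hε : 0 < ε) (hα : IsKarasevMap π ε U α)
    (hΓ : IsSprayFamily π ε U α Γ) {z : Pt n × Pt n} (hz : z ∈ U) (Y : Pt n × Pt n) :
    ∃ ξ, IsVariation π ε α Γ z Y ξ := by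
  have hc := hΓ.continuousOn_fst hz
  have hA : ContinuousOn (fun s => sprayMatrix π (Γ z s).1 z.2) (Icc 0 ε) :=
    (continuous_sprayMatrix hπ z.2).comp_continuousOn hc
  have hg : ContinuousOn (fun s => π (Γ z s).1 *ᵥ Y.2) (Icc 0 ε) :=
    ((continuous_tensor hπ).matrix_mulVec continuous_const).comp_continuousOn hc
  obtain ⟨ξ, hξ0, hξ⟩ := exists_affine_ode_solution hε.le
    (continuous_mulVecCLM.comp_continuousOn hA) hg (fderiv ℝ α z Y)
  replace hξ : ∀ s ∈ Icc 0 ε, HasDerivWithinAt ξ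
    (sprayMatrix π (Γ z s).1 z.2 *ᵥ ξ s + π (Γ z s).1 *ᵥ Y.2) (Icc 0 ε) s := hξ
  have hline := hasDerivAt_line z Y
  have hU : ∀ᶠ τ in 𝓝 (0 : ℝ), z + τ • Y ∈ U :=
    hline.continuousAt.eventually (by simpa using hα.isOpen.mem_nhds hz)
  have hΓ0 : Γ (z + (0 : ℝ) • Y) = Γ z := by simp
  have hstart : HasDerivAt (fun τ : ℝ => Γ (z + τ • Y) 0) (ξ 0, Y.2) 0 := by
    have h1 : HasDerivAt (fun τ : ℝ => (α (z + τ • Y), (z + τ • Y).2)) (ξ 0, Y.2) 0 := by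
      refine HasDerivAt.prodMk ?_ hline.snd
      rw [hξ0]
      exact HasFDerivAt.comp_hasDerivAt_of_eq (0 : ℝ) (hα.hasFDerivAt hz) hline (by simp)
    exact h1.congr_of_eventuallyEq (hU.mono fun τ hτ => hΓ.start _ hτ)
  have hvar : ∀ e > 0, ∀ᶠ τ in 𝓝 (0 : ℝ), ∀ s ∈ Icc 0 ε,
      ‖Γ (z + τ • Y) s - Γ z s - τ • (ξ s, Y.2)‖ ≤ e * |τ| := by
    intro e he
    have := isLittleO_first_variation 
      (by exact_mod_cast contDiff_infty.1 (contDiff_spray hπ) 2) (v := spray π)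
      (γ := fun τ => Γ (z + τ • Y)) (Ξ := fun s => (ξ s, Y.2)) hε.le
      (hU.mono fun τ hτ => hΓ.curve _ hτ)
      (fun s hs => by
        simp only [hΓ0]
        rw [← Prod.mk.eta (p := Γ z s), hΓ.snd_eq hz hs, fderiv_spray hπ]
        exact (hξ s hs).prodMk (hasDerivWithinAt_const _ _ _)) hstart he
    simpa only [hΓ0] using this
  have hvar1 : ∀ e > 0, ∀ᶠ τ in 𝓝 (0 : ℝ), ∀ s ∈ Icc 0 ε,
      ‖(Γ (z + τ • Y) s).1 - (Γ z s).1 - τ • ξ s‖ ≤ e * |τ| := fun e he =>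
    (hvar e he).mono fun τ h s hs => (norm_fst_le _).trans (h s hs)
  have hξc : ContinuousOn ξ (Icc 0 ε) := fun s hs => (hξ s hs).continuousWithinAt
  have hint : ∀ {f : ℝ → Pt n}, ContinuousOn f (Icc 0 ε) →
      IntervalIntegrable f MeasureTheory.volume 0 ε := fun hf =>
    hf.intervalIntegrable_of_Icc hε.le
  refine ⟨ξ, hξ0, hξ, ?_, ?_⟩
  -- Both curves satisfy the averaging constraint, so the integrated difference is `τ` times the
  -- quantity to be bounded. One small nonzero `τ` is enough for each `e`.
  · have hsmall : ∀ e > 0, ‖ε • Y.1 - ∫ s in (0 : ℝ)..ε, ξ s‖ ≤ e := by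
      intro e he
      have h1 : ∀ᶠ τ in 𝓝[≠] (0 : ℝ), z + τ • Y ∈ U ∧ ∀ s ∈ Icc 0 ε,
          ‖(Γ (z + τ • Y) s).1 - (Γ z s).1 - τ • ξ s‖ ≤ e / ε * |τ| :=
        ((hU.and (hvar1 (e / ε) (by positivity))).filter_mono nhdsWithin_le_nhds)
      obtain ⟨τ, ⟨hτU, hτ⟩, hτ0⟩ := (h1.and self_mem_nhdsWithin).exists
      have h2 := intervalIntegral.norm_integral_le_of_norm_le_const (a := 0) (b := ε)
        (f := fun s => (Γ (z + τ • Y) s).1 - (Γ z s).1 - τ • ξ s) (C := e / ε * |τ|)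
        (fun s hs => hτ s (by rw [uIoc_of_le hε.le] at hs; exact Ioc_subset_Icc_self hs))
      have hτξ : ContinuousOn (fun s => τ • ξ s) (Icc 0 ε) := hξc.const_smul τ
      rw [intervalIntegral.integral_sub ((hint (hΓ.continuousOn_fst hτU)).sub (hint hc))
        (hint hτξ), intervalIntegral.integral_sub (hint (hΓ.continuousOn_fst hτU))
        (hint hc), intervalIntegral.integral_smul, integral_eq_of_xAverage hε (hΓ.average _ hτU),
        integral_eq_of_xAverage hε (hΓ.average _ hz)] at h2
      have h3 : ε • (z + τ • Y).1 - ε • z.1 - τ • ∫ s in (0 : ℝ)..ε, ξ s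
          = τ • (ε • Y.1 - ∫ s in (0 : ℝ)..ε, ξ s) := by
        simp only [Prod.fst_add, Prod.smul_fst]
        module
      rw [h3, norm_smul, Real.norm_eq_abs, sub_zero, abs_of_pos hε] at h2
      have h4 : 0 < |τ| := abs_pos.2 hτ0
      have h5 : e / ε * |τ| * ε = |τ| * e := by field_simp
      rw [h5] at h2
      exact le_of_mul_le_mul_left h2 h4
    have := le_of_forall_pos_le_add (b := (0 : ℝ)) (fun e he => by simpa using hsmall e he)
    exact (sub_eq_zero.1 (norm_le_zero_iff.1 this)).symm
  · rw [hasDerivAt_iff_isLittleO, Asymptotics.isLittleO_iff]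
    intro e he
    filter_upwards [hvar1 e he] with τ hτ
    simpa using hτ ε (right_mem_Icc.2 hε.le)

theorem IsVariation.continuousOn {z Y : Pt n × Pt n} {ξ : ℝ → Pt n}
    (h : IsVariation π ε α Γ z Y ξ) : ContinuousOn ξ (Icc 0 ε) :=
  fun s hs => (h.deriv s hs).continuousWithinAt

theorem IsSprayFamily.continuousOn_sprayMatrix (hπ : IsPoissonTensor π)
    (hΓ : IsSprayFamily π ε U α Γ) {z : Pt n × Pt n} (hz : z ∈ U) :
    ContinuousOn (fun s => sprayMatrix π (Γ z s).1 z.2) (Icc 0 ε) :=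
  (continuous_sprayMatrix hπ z.2).comp_continuousOn (hΓ.continuousOn_fst hz)

theorem integral_congr_Icc (hε : 0 < ε) {f g : ℝ → Pt n} (h : EqOn f g (Icc 0 ε)) :
    ∫ s in (0 : ℝ)..ε, f s = ∫ s in (0 : ℝ)..ε, g s :=
  intervalIntegral.integral_congr (by rwa [uIcc_of_le hε.le])

/-- The partial differential of the realization map along `M` is injective. -/
theorem fderiv_karasev_injective (hπ : IsPoissonTensor π) (hε : 0 < ε)
    (hα : IsKarasevMap π ε U α) (hΓ : IsSprayFamily π ε U α Γ) {z : Pt n × Pt n} (hz : z ∈ U) :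
    Function.Injective ((fderiv ℝ α z).comp (ContinuousLinearMap.inl ℝ (Pt n) (Pt n))) := by
  rw [injective_iff_map_eq_zero]
  intro v hv
  obtain ⟨ξ, hξ⟩ := exists_isVariation hπ hε hα hΓ hz (v, 0)
  -- With zero initial value and no momentum variation the equation is homogeneous, so `ξ` vanishes;
  -- but its integral is `ε • v`.
  have h0 : EqOn ξ (fun _ => 0) (Icc 0 ε) :=
    eqOn_of_linear_ode (g := fun _ => 0) (hΓ.continuousOn_sprayMatrix hπ hz)
      (fun s hs => by simpa using hξ.deriv s hs)
      (fun s _ => by simpa using hasDerivWithinAt_const _ _ _) (by rw [hξ.start]; exact hv)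
  have h1 := hξ.integral
  rw [integral_congr_Icc hε h0] at h1
  simpa [hε.ne'] using h1.symm

theorem fderiv_karasev_surjective (hπ : IsPoissonTensor π) (hε : 0 < ε)
    (hα : IsKarasevMap π ε U α) (hΓ : IsSprayFamily π ε U α Γ) {z : Pt n × Pt n} (hz : z ∈ U)
    (w : Pt n) : ∃ v : Pt n, fderiv ℝ α z (v, 0) = w :=
  LinearMap.surjective_of_injective
    (f := ((fderiv ℝ α z).comp (ContinuousLinearMap.inl ℝ (Pt n) (Pt n))).toLinearMap)
    (fderiv_karasev_injective hπ hε hα hΓ hz) w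

/-- The vector at `z` which is dual to the form `d(f ∘ α)` under `dpᵢ ∧ dxⁱ`. -/
def dualVector (α : Pt n × Pt n → Pt n) (z : Pt n × Pt n) (f : Pt n →L[ℝ] ℝ) : Pt n × Pt n :=
  (fun i => -f (fderiv ℝ α z (0, Pi.single i 1)), fun i => f (fderiv ℝ α z (Pi.single i 1, 0)))

/-- The left side is `dpᵢ ∧ dxⁱ` evaluated on the pair; this fixes the signs in `dualVector`. -/
theorem dualVector_pairing (z : Pt n × Pt n) (f : Pt n →L[ℝ] ℝ) (Y : Pt n × Pt n) :
    (dualVector α z f).2 ⬝ᵥ Y.1 - (dualVector α z f).1 ⬝ᵥ Y.2 = f (fderiv ℝ α z Y) := by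
  have h1 : ∀ L : Pt n →L[ℝ] ℝ, ∀ v : Pt n, L v = ∑ i, L (Pi.single i 1) * v i := by
    intro L v
    conv_lhs => rw [pi_eq_sum_univ' v]
    simp [map_sum, mul_comm]
  have h2 := h1 ((f.comp (fderiv ℝ α z)).comp (ContinuousLinearMap.inl ℝ (Pt n) (Pt n))) Y.1
  have h3 := h1 ((f.comp (fderiv ℝ α z)).comp (ContinuousLinearMap.inr ℝ (Pt n) (Pt n))) Y.2
  have h4 : Y = (Y.1, 0) + (0, Y.2) := by simp
  conv_rhs => rw [h4, map_add, map_add]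
  simp only [ContinuousLinearMap.comp_apply, ContinuousLinearMap.inl_apply,
    ContinuousLinearMap.inr_apply] at h2 h3
  rw [h2, h3]
  simp [dualVector, dotProduct]

theorem dotProduct_mulVec_skew (hπ : IsPoissonTensor π) (y v w : Pt n) :
    v ⬝ᵥ (π y *ᵥ w) = -(w ⬝ᵥ (π y *ᵥ v)) := by
  have : (π y)ᵀ = -π y := by
    ext i j
    exact hπ.skew y i j
  rw [dotProduct_mulVec, ← mulVec_transpose, this, neg_mulVec, neg_dotProduct, dotProduct_comm]

/-- The endpoint of the curves of the family does not vary along the Hamiltonian vectors of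
functions of their starting point. -/
theorem IsVariation.endpoint_eq_zero (hπ : IsPoissonTensor π) (hε : 0 < ε)
    (hα : IsKarasevMap π ε U α) (hΓ : IsSprayFamily π ε U α Γ) {z : Pt n × Pt n} (hz : z ∈ U)
    (f : Pt n →L[ℝ] ℝ) {η : ℝ → Pt n} (hη : IsVariation π ε α Γ z (dualVector α z f) η) :
    η ε = 0 := by
  set X := dualVector α z f with hX
  set y : ℝ → Pt n := fun s => (Γ z s).1 with hy
  set A : ℝ → Matrix (Fin n) (Fin n) ℝ := fun s => sprayMatrix π (y s) z.2 with hA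
  have hAc : ContinuousOn A (Icc 0 ε) := hΓ.continuousOn_sprayMatrix hπ hz
  -- The adjoint equation, driven by the momentum part of `X`. The terminal value zero removes the
  -- boundary term at `ε` below.
  obtain ⟨θ, hθε, hθ⟩ := exists_affine_ode_solution_terminal hε.le (g := fun _ => X.2)
    (continuous_mulVecCLM.comp_continuousOn
      ((continuous_id.matrix_transpose.neg).comp_continuousOn hAc)) continuousOn_const (0 : Pt n)
  replace hθ : ∀ s ∈ Icc 0 ε, HasDerivWithinAt θ (-((A s)ᵀ *ᵥ θ s) + X.2) (Icc 0 ε) s :=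
    fun s hs => (hθ s hs).congr_deriv (by simp [Matrix.toLin'_apply])
  have hθc : ContinuousOn θ (Icc 0 ε) := fun s hs => (hθ s hs).continuousWithinAt
  have hπy : ContinuousOn (fun s => π (y s)) (Icc 0 ε) :=
    (continuous_tensor hπ).comp_continuousOn (hΓ.continuousOn_fst hz)
  have hπθc : ContinuousOn (fun s => π (y s) *ᵥ θ s) (Icc 0 ε) :=
    (Continuous.matrix_mulVec continuous_fst continuous_snd).comp_continuousOn (hπy.prodMk hθc)
  have hint : ∀ {f : ℝ → Pt n}, ContinuousOn f (Icc 0 ε) →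
      IntervalIntegrable f MeasureTheory.volume 0 ε := fun hf =>
    hf.intervalIntegrable_of_Icc hε.le
  set I := ∫ s in (0 : ℝ)..ε, π (y s) *ᵥ θ s with hI
  -- Integrate the derivative of `θ ⬝ᵥ ξ`: the terms with `A` cancel, skew symmetry moves the tensor
  -- onto `θ`, and `∫ ξ = ε • Y.1`.
  have hstokes : ∀ Y : Pt n × Pt n,
      ε * (X.2 ⬝ᵥ Y.1) - Y.2 ⬝ᵥ I = -(θ 0 ⬝ᵥ fderiv ℝ α z Y) := by
    intro Y
    obtain ⟨ξ, hξ⟩ := exists_isVariation hπ hε hα hΓ hz Y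
    have hd : ∀ s ∈ Icc 0 ε, HasDerivWithinAt (fun s => θ s ⬝ᵥ ξ s)
        (dotCLM X.2 (ξ s) - dotCLM Y.2 (π (y s) *ᵥ θ s)) (Icc 0 ε) s := fun s hs => by
      refine (hasDerivWithinAt_dotProduct (hθ s hs) (hξ.deriv s hs)).congr_deriv ?_
      rw [dotCLM_apply, dotCLM_apply, dotProduct_add, add_dotProduct, neg_dotProduct,
        mulVec_transpose, ← dotProduct_mulVec, dotProduct_mulVec_skew hπ]
      simp only [hA, hy]
      ring
    have hc1 : ContinuousOn (fun s => dotCLM X.2 (ξ s)) (Icc 0 ε) :=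
      (dotCLM X.2).continuous.comp_continuousOn hξ.continuousOn
    have hc2 : ContinuousOn (fun s => dotCLM Y.2 (π (y s) *ᵥ θ s)) (Icc 0 ε) :=
      (dotCLM Y.2).continuous.comp_continuousOn hπθc
    have hftc := intervalIntegral.integral_eq_sub_of_hasDerivAt_of_le hε.le
      (fun s hs => (hd s hs).continuousWithinAt)
      (fun s hs => (hd s (Ioo_subset_Icc_self hs)).hasDerivAt (Icc_mem_nhds hs.1 hs.2))
      ((hc1.sub hc2).intervalIntegrable_of_Icc hε.le)
    rw [intervalIntegral.integral_sub (hc1.intervalIntegrable_of_Icc hε.le)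
      (hc2.intervalIntegrable_of_Icc hε.le),
      (dotCLM X.2).intervalIntegral_comp_comm (hint hξ.continuousOn),
      (dotCLM Y.2).intervalIntegral_comp_comm (hint hπθc), hξ.integral, hξ.start, hθε,
      dotCLM_apply, dotCLM_apply, dotProduct_smul, zero_dotProduct, zero_sub, smul_eq_mul] at hftc
    exact hftc
  have hpair : ∀ Y : Pt n × Pt n,
      ε * f (fderiv ℝ α z Y) + θ 0 ⬝ᵥ fderiv ℝ α z Y = Y.2 ⬝ᵥ (I - ε • X.1) := by
    intro Y
    have h1 := hstokes Y
    have h2 := dualVector_pairing (α := α) z f Y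
    rw [← hX] at h2
    rw [← h2, dotProduct_sub, dotProduct_smul, smul_eq_mul, dotProduct_comm Y.2 X.1]
    linarith
  -- For `Y = (v, 0)` the right side of `hpair` vanishes, and `dα(v, 0)` is arbitrary. Thus the left
  -- side vanishes for every `Y`, which forces `I = ε • X.1`.
  have hcov : ∀ w : Pt n, ε * f w + θ 0 ⬝ᵥ w = 0 := by
    intro w
    obtain ⟨v, hv⟩ := fderiv_karasev_surjective hπ hε hα hΓ hz w
    simpa [hv] using hpair (v, 0)
  have hIX : I = ε • X.1 := by
    rw [← sub_eq_zero]
    refine dotProduct_eq_zero _ fun w => ?_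
    rw [dotProduct_comm, ← hpair (0, w), hcov]
  -- Since the spray preserves the tensor, `π θ` solves the same inhomogeneous equation as `η`, so
  -- `ζ` solves the homogeneous one. Its integral is `I - ε • X.1 = 0`.
  set ζ : ℝ → Pt n := fun s => π (y s) *ᵥ θ s - η s with hζ
  have hζd : ∀ s ∈ Icc 0 ε, HasDerivWithinAt ζ (A s *ᵥ ζ s + 0) (Icc 0 ε) s := by
    intro s hs
    have hyd : HasDerivWithinAt y (π (y s) *ᵥ z.2) (Icc 0 ε) s := by
      refine (hasFDerivAt_fst.comp_hasDerivWithinAt s (hΓ.curve z hz s hs)).congr_deriv ?_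
      simp only [spray_eq hπ, hΓ.snd_eq hz hs]
      rfl
    have h1 : HasDerivWithinAt (fun s => π (y s) *ᵥ θ s)
        (A s *ᵥ (π (y s) *ᵥ θ s) + π (y s) *ᵥ X.2) (Icc 0 ε) s := by
      refine hasDerivWithinAt_pi.2 fun a => ?_
      have h2 : HasDerivWithinAt (fun s => ∑ b, π (y s) a b * θ s b)
          (∑ b, (fderiv ℝ (fun x => π x a b) (y s) (π (y s) *ᵥ z.2) * θ s b
            + π (y s) a b * (-((A s)ᵀ *ᵥ θ s) + X.2) b)) (Icc 0 ε) s :=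
        HasDerivWithinAt.fun_sum fun b _ =>
          ((hasFDerivAt_entry hπ a b (y s)).comp_hasDerivWithinAt s hyd).fun_mul
            (hasDerivWithinAt_pi.1 (hθ s hs) b)
      refine h2.congr_deriv ?_
      rw [Finset.sum_add_distrib, hπ.lieDerivative_eq_zero]
      have h3 : ∑ b, π (y s) a b * (-((A s)ᵀ *ᵥ θ s) + X.2) b
          = (π (y s) *ᵥ (-((A s)ᵀ *ᵥ θ s) + X.2)) a := rfl
      rw [h3, mulVec_add, mulVec_neg]
      simp only [Pi.add_apply, Pi.neg_apply, hA]
      ring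
    refine (h1.fun_sub (hη.deriv s hs)).congr_deriv ?_
    simp only [hζ, mulVec_sub, hA, hy]
    abel
  have hζint : ∫ s in (0 : ℝ)..ε, ζ s = 0 := by
    rw [intervalIntegral.integral_sub (hint hπθc) (hint hη.continuousOn), hη.integral, ← hI, hIX,
      sub_self]
  -- Every homogeneous solution is the variation in some direction `(v, 0)` and has integral `ε •
  -- v`; hence `ζ = 0`. At time `ε`, `θ` vanishes and so does `η`.
  obtain ⟨v, hv⟩ := fderiv_karasev_surjective hπ hε hα hΓ hz (ζ 0)
  obtain ⟨ξ, hξ⟩ := exists_isVariation hπ hε hα hΓ hz (v, 0)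
  have hζξ : EqOn ζ ξ (Icc 0 ε) := eqOn_of_linear_ode (g := fun _ => 0) hAc hζd
    (fun s hs => by simpa using hξ.deriv s hs) (by rw [hξ.start, hv])
  have hv0 : v = 0 := by
    have h1 := hξ.integral
    rw [← integral_congr_Icc hε hζξ, hζint] at h1
    simpa [hε.ne'] using h1.symm
  have hζ0 : EqOn ζ (fun _ => 0) (Icc 0 ε) := eqOn_of_linear_ode (g := fun _ => 0) hAc hζd
    (fun s _ => by simpa using hasDerivWithinAt_const _ _ _) (by
      rw [← hv, hv0]
      exact map_zero _)
  have h1 := hζ0 (right_mem_Icc.2 hε.le)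
  simpa [hζ, hθε] using h1

end

section

open Filter Metric Matrix

/-! ### The realization map and its dual commute -/

variable {n : ℕ} {π : Pt n → Matrix (Fin n) (Fin n) ℝ} {ε : ℝ} {U : Set (Pt n × Pt n)}
  {α : Pt n × Pt n → Pt n} {Γ : Pt n × Pt n → ℝ → Pt n × Pt n}

/-- The reflection `(x, p) ↦ (x, -p)` of `T*M`. -/
def reflect (z : Pt n × Pt n) : Pt n × Pt n := (z.1, -z.2)

theorem contDiff_reflect : ContDiff ℝ ∞ (reflect (n := n)) :=
  contDiff_fst.prodMk contDiff_snd.neg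

theorem IsKarasevMap.reflect_mem (hα : IsKarasevMap π ε U α) {z : Pt n × Pt n} (hz : z ∈ U) :
    reflect z ∈ U := hα.neg_mem z.1 z.2 hz

theorem IsKarasevMap.contDiffAt (hα : IsKarasevMap π ε U α) {z : Pt n × Pt n} (hz : z ∈ U) :
    ContDiffAt ℝ ∞ α z := hα.smooth.contDiffAt (hα.isOpen.mem_nhds hz)

theorem SprayAverage.unique (hπ : IsPoissonTensor π) (hε : 0 < ε) {y p x x' : Pt n}
    (h : SprayAverage π ε y p x) (h' : SprayAverage π ε y p x') : x = x' := by
  obtain ⟨γ, h0, hγ, hx⟩ := h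
  obtain ⟨γ', h0', hγ', hx'⟩ := h'
  have he := eqOn_of_isIntegralCurveOn ((contDiff_spray hπ).of_le (by simp)) hγ hγ'
    (h0.trans h0'.symm)
  rw [← hx, ← hx', xAverage, xAverage, if_neg hε.ne', if_neg hε.ne']
  congr 1
  exact integral_congr_Icc hε fun s hs => by rw [he hs]

/-- Run the trajectory backwards from its endpoint with momentum `-p`: the spray is odd in the
momentum, and reversal does not change the average. -/
theorem IsSprayFamily.sprayAverage_endpoint (hπ : IsPoissonTensor π) (hε : 0 < ε)
    (hΓ : IsSprayFamily π ε U α Γ) {z : Pt n × Pt n} (hz : z ∈ U) :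
    SprayAverage π ε (Γ z ε).1 (-z.2) z.1 := by
  refine ⟨fun s => ((Γ z (ε - s)).1, -z.2), by simp, fun s hs => ?_, ?_⟩
  · have hmap : MapsTo (fun s : ℝ => ε - s) (Icc 0 ε) (Icc 0 ε) := fun s hs =>
      ⟨by linarith [hs.2], by linarith [hs.1]⟩
    have h1 := hasFDerivAt_fst.comp_hasDerivWithinAt (ε - s) (hΓ.curve z hz (ε - s) (hmap hs))
    have h2 := h1.scomp s ((hasDerivAt_id s).const_sub ε).hasDerivWithinAt hmap
    simp only [spray_eq hπ, hΓ.snd_eq hz (hmap hs)] at h2 ⊢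
    refine HasDerivWithinAt.prodMk ?_ (hasDerivWithinAt_const _ _ _)
    refine h2.congr_deriv ?_
    simp [mulVec_neg]
  · rw [xAverage, if_neg hε.ne']
    have h := intervalIntegral.integral_comp_sub_left (a := 0) (b := ε) (fun s => (Γ z s).1) ε
    simp only [sub_self, sub_zero] at h
    simp only [h, integral_eq_of_xAverage hε (hΓ.average z hz), smul_smul,
      inv_mul_cancel₀ hε.ne', one_smul]

theorem IsSprayFamily.continuousOn_endpoint (hπ : IsPoissonTensor π) (hε : 0 < ε)
    (hα : IsKarasevMap π ε U α) (hΓ : IsSprayFamily π ε U α Γ) :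
    ContinuousOn (fun z => (Γ z ε).1) U := by
  intro z hz
  refine (continuous_fst.tendsto _).comp (tendsto_of_isIntegralCurveOn
    ((contDiff_spray hπ).of_le (by simp)) (γ := Γ) (γ₀ := Γ z) (l := 𝓝[U] z)
    (eventually_mem_nhdsWithin.mono fun w hw => hΓ.curve w hw) (hΓ.curve z hz) ?_
    (right_mem_Icc.2 hε.le))
  rw [hΓ.start z hz]
  have h1 : Tendsto (fun w => (α w, w.2)) (𝓝[U] z) (𝓝 (α z, z.2)) :=
    ((hα.smooth.continuousOn z hz).prodMk continuous_snd.continuousWithinAt)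
  exact h1.congr' (eventually_mem_nhdsWithin.mono fun w hw => (hΓ.start w hw).symm)

/-- Near `(α z, z.2)` the equation `φ_ε(y, p) = x` determines `y = α(x, p)`. -/
theorem eventually_eq_of_sprayAverage (hπ : IsPoissonTensor π) (hε : 0 < ε)
    (hα : IsKarasevMap π ε U α) (hΓ : IsSprayFamily π ε U α Γ) {z : Pt n × Pt n} (hz : z ∈ U) :
    ∀ᶠ q in 𝓝 (α z, z.2), ∀ x, SprayAverage π ε q.1 q.2 x → q.1 = α (x, q.2) := by
  have hs : HasStrictFDerivAt α (fderiv ℝ α z) z :=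
    (hα.contDiffAt hz).hasStrictFDerivAt (by simp)
  have hΨ : HasStrictFDerivAt (fun w => (α w, w.2))
      ((fderiv ℝ α z).prod (ContinuousLinearMap.snd ℝ (Pt n) (Pt n))) z :=
    hs.prodMk hasStrictFDerivAt_snd
  have hsurj : ((fderiv ℝ α z).prod (ContinuousLinearMap.snd ℝ (Pt n) (Pt n))).range = ⊤ := by
    rw [LinearMap.range_eq_top]
    intro w
    obtain ⟨v, hv⟩ := fderiv_karasev_surjective hπ hε hα hΓ hz (w.1 - fderiv ℝ α z (0, w.2))
    refine ⟨(v, w.2), ?_⟩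
    have h4 : (v, w.2) = (v, 0) + (0, w.2) := by simp
    refine Prod.ext ?_ rfl
    change fderiv ℝ α z (v, w.2) = w.1
    rw [h4, map_add, hv, sub_add_cancel]
  -- A submersion is locally onto, so every nearby `q` is `(α w, w.2)` with `w ∈ U`; uniqueness of
  -- the average then identifies `x` with `w.1`.
  have hmap := hΨ.map_nhds_eq_of_surj hsurj
  rw [← hmap]
  refine eventually_map.2 ?_
  filter_upwards [hα.isOpen.mem_nhds hz] with w hw x hx
  have h1 := SprayAverage.unique hπ hε hx (hα.implicit w.1 w.2 hw)
  rw [h1]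

/-- The points of `U` at which the dual realization map is the endpoint map of the family. -/
def dualitySet (ε : ℝ) (U : Set (Pt n × Pt n)) (α : Pt n × Pt n → Pt n)
    (Γ : Pt n × Pt n → ℝ → Pt n × Pt n) : Set (Pt n × Pt n) :=
  {z | z ∈ U ∧ (Γ z ε).1 = α (reflect z)}

theorem IsKarasevMap.continuousOn_dual (hα : IsKarasevMap π ε U α) :
    ContinuousOn (fun z => α (reflect z)) U :=
  hα.smooth.continuousOn.comp contDiff_reflect.continuous.continuousOn
    fun _ hz => hα.reflect_mem hz

/-- The endpoint depends continuously on `z`, so near a point of the set it stays where the implicit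
equation has only the solution given by `α`. -/
theorem isOpen_dualitySet (hπ : IsPoissonTensor π) (hε : 0 < ε)
    (hα : IsKarasevMap π ε U α) (hΓ : IsSprayFamily π ε U α Γ) :
    IsOpen (dualitySet ε U α Γ) := by
  rw [isOpen_iff_mem_nhds]
  rintro z ⟨hz, hzd⟩
  have h1 := eventually_eq_of_sprayAverage hπ hε hα hΓ (hα.reflect_mem hz)
  have h2 : Tendsto (fun w : Pt n × Pt n => ((Γ w ε).1, -w.2)) (𝓝 z)
      (𝓝 (α (reflect z), (reflect z).2)) := by
    rw [← hzd]
    exact ((hΓ.continuousOn_endpoint hπ hε hα).continuousAt (hα.isOpen.mem_nhds hz)).prodMk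
      continuous_snd.neg.continuousAt
  filter_upwards [h2.eventually h1, hα.isOpen.mem_nhds hz] with w hw hwU
  exact ⟨hwU, hw w.1 (hΓ.sprayAverage_endpoint hπ hε hwU)⟩

theorem mem_dualitySet_of_mem_closure (hπ : IsPoissonTensor π) (hε : 0 < ε)
    (hα : IsKarasevMap π ε U α) (hΓ : IsSprayFamily π ε U α Γ) {z : Pt n × Pt n} (hz : z ∈ U)
    (hcl : z ∈ closure (dualitySet ε U α Γ)) : z ∈ dualitySet ε U α Γ := by
  have : (𝓝[dualitySet ε U α Γ] z).NeBot := mem_closure_iff_nhdsWithin_neBot.1 hcl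
  have hsub : dualitySet ε U α Γ ⊆ U := fun w hw => hw.1
  have h1 := ((hΓ.continuousOn_endpoint hπ hε hα) z hz).mono hsub
  have h2 := (hα.continuousOn_dual z hz).mono hsub
  refine ⟨hz, tendsto_nhds_unique h1 (h2.congr' ?_)⟩
  exact eventually_mem_nhdsWithin.mono fun w hw => hw.2.symm

theorem zero_mem_dualitySet (hπ : IsPoissonTensor π) (hε : 0 < ε)
    (hα : IsKarasevMap π ε U α) (hΓ : IsSprayFamily π ε U α Γ) (x : Pt n) :
    (x, 0) ∈ dualitySet ε U α Γ := by
  have hz := hα.zero_mem x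
  refine ⟨hz, ?_⟩
  have h1 : IsIntegralCurveOn (fun _ : ℝ => ((x, 0) : Pt n × Pt n)) (fun _ => spray π)
      (Icc 0 ε) := fun s _ => by
    simp only [spray_eq hπ, mulVec_zero]
    exact hasDerivWithinAt_const _ _ _
  have h2 := eqOn_of_isIntegralCurveOn ((contDiff_spray hπ).of_le (by simp)) (hΓ.curve _ hz) h1
    (by simp [hΓ.start _ hz, hα.map_zero]) (right_mem_Icc.2 hε.le)
  simp [h2, reflect, hα.map_zero]

/-- As `dualitySet` is open, the dual map coincides near `z` with the endpoint map, whose derivative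
in this direction vanishes. -/
theorem fderiv_dual_dualVector (hπ : IsPoissonTensor π) (hε : 0 < ε)
    (hα : IsKarasevMap π ε U α) (hΓ : IsSprayFamily π ε U α Γ) {z : Pt n × Pt n}
    (hz : z ∈ dualitySet ε U α Γ) (f : Pt n →L[ℝ] ℝ) :
    fderiv ℝ (fun w => α (reflect w)) z (dualVector α z f) = 0 := by
  set X := dualVector α z f
  obtain ⟨η, hη⟩ := exists_isVariation hπ hε hα hΓ hz.1 X
  have h1 : HasFDerivAt (fun w => α (reflect w)) (fderiv ℝ (fun w => α (reflect w)) z) z :=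
    (((hα.contDiffAt (hα.reflect_mem hz.1)).comp z contDiff_reflect.contDiffAt).differentiableAt
      (by simp)).hasFDerivAt
  have hline := hasDerivAt_line z X
  have h2 : HasDerivAt (fun τ : ℝ => α (reflect (z + τ • X)))
      (fderiv ℝ (fun w => α (reflect w)) z X) 0 :=
    HasFDerivAt.comp_hasDerivAt_of_eq (l := fun w => α (reflect w)) (0 : ℝ) h1 hline (by simp)
  have hev : ∀ᶠ τ in 𝓝 (0 : ℝ), z + τ • X ∈ dualitySet ε U α Γ :=
    hline.continuousAt.eventually (by simpa using (isOpen_dualitySet hπ hε hα hΓ).mem_nhds hz)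
  have h3 := hη.endpoint.congr_of_eventuallyEq (hev.mono fun τ hτ => hτ.2.symm)
  rw [h2.unique h3]
  exact hη.endpoint_eq_zero hπ hε hα hΓ hz.1 f

theorem hamiltonianField_comp {H : Pt n → ℝ} (hH : ContDiff ℝ ∞ H) (hα : IsKarasevMap π ε U α)
    {z : Pt n × Pt n} (hz : z ∈ U) :
    hamiltonianField (H ∘ α) z = dualVector α z (fderiv ℝ H (α z)) := by
  have h : fderiv ℝ (H ∘ α) z = (fderiv ℝ H (α z)).comp (fderiv ℝ α z) :=
    fderiv_comp z (hH.differentiable (by simp) _) (hα.hasFDerivAt hz).differentiableAt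
  simp only [hamiltonianField, dualVector, h, ContinuousLinearMap.comp_apply]

theorem contDiffAt_comp_karasev {H : Pt n → ℝ} (hH : ContDiff ℝ ∞ H) (hα : IsKarasevMap π ε U α)
    {z : Pt n × Pt n} (hz : z ∈ U) : ContDiffAt ℝ ∞ (H ∘ α) z :=
  hH.contDiffAt.comp z (hα.contDiffAt hz)

/-- The difference between `H ∘ α` and its reflection. -/
def defect (G : Pt n × Pt n → ℝ) (z : Pt n × Pt n) : ℝ := G z - G (reflect z)

/-- On a neighbourhood `D` of the zero section which is closed in `U`, the function `H ∘ α`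
commutes with its reflection. -/
theorem exists_commutation_set (hπ : IsPoissonTensor π) (hε : 0 ≤ ε)
    (hα : IsKarasevMap π ε U α) {H : Pt n → ℝ} (hH : ContDiff ℝ ∞ H) :
    ∃ D ⊆ U, IsOpen D ∧ (∀ x, (x, 0) ∈ D) ∧ (∀ z ∈ U, z ∈ closure D → z ∈ D) ∧
      ∀ z ∈ D, fderiv ℝ (defect (H ∘ α)) z (hamiltonianField (H ∘ α) z) = 0 := by
  rcases hε.eq_or_lt with rfl | hε
  · refine ⟨U, Subset.rfl, hα.isOpen, hα.zero_mem, fun z hz _ => hz, fun z hz => ?_⟩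
    have h0 : ∀ z ∈ U, α z = z.1 := fun z hz => by
      obtain ⟨γ, h1, -, h2⟩ := hα.implicit z.1 z.2 hz
      rw [xAverage, if_pos rfl, h1] at h2
      exact h2
    have h1 : defect (H ∘ α) =ᶠ[𝓝 z] fun _ => 0 := by
      filter_upwards [hα.isOpen.mem_nhds hz] with w hw
      have h2 := h0 _ (hα.reflect_mem hw)
      simp only [defect, Function.comp_apply, h0 w hw, h2]
      exact sub_self _
    rw [h1.fderiv_eq]
    simp
  · obtain ⟨Γ, hΓ⟩ := hα.exists_isSprayFamily
    refine ⟨dualitySet ε U α Γ, fun z hz => hz.1, isOpen_dualitySet hπ hε hα hΓ,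
      zero_mem_dualitySet hπ hε hα hΓ,
      fun z hz hcl => mem_dualitySet_of_mem_closure hπ hε hα hΓ hz hcl, fun z hz => ?_⟩
    have hd1 := (contDiffAt_comp_karasev hH hα hz.1).differentiableAt (by simp)
    have hdual : DifferentiableAt ℝ (fun w => α (reflect w)) z :=
      ((hα.contDiffAt (hα.reflect_mem hz.1)).comp z
        contDiff_reflect.contDiffAt).differentiableAt (by simp)
    have hHd := hH.differentiable (by simp)
    have hd2 : fderiv ℝ (fun w => (H ∘ α) (reflect w)) z
        = (fderiv ℝ H (α (reflect z))).comp (fderiv ℝ (fun w => α (reflect w)) z) :=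
      fderiv_comp z (hHd _) hdual
    have hd2' : DifferentiableAt ℝ (fun w => (H ∘ α) (reflect w)) z := (hHd _).comp z hdual
    have hd1' : fderiv ℝ (H ∘ α) z = (fderiv ℝ H (α z)).comp (fderiv ℝ α z) :=
      fderiv_comp z (hHd _) (hα.hasFDerivAt hz.1).differentiableAt
    have hsub : fderiv ℝ (defect (H ∘ α)) z
        = fderiv ℝ (H ∘ α) z - fderiv ℝ (fun w => (H ∘ α) (reflect w)) z :=
      fderiv_fun_sub hd1 hd2'
    rw [hsub, hd2, hd1', hamiltonianField_comp hH hα hz.1]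
    -- The reflected term vanishes by duality. What remains is the derivative of `H ∘ α` along its
    -- own Hamiltonian vector, zero by antisymmetry of the symplectic form.
    simp only [_root_.sub_apply, ContinuousLinearMap.comp_apply,
      fderiv_dual_dualVector hπ hε hα hΓ hz, map_zero, sub_zero, ← dualVector_pairing]
    rw [dotProduct_comm, sub_self]

end

section

open Filter Metric

/-! ### Uniqueness for first-order differential inequalities -/

section Haar

variable {E : Type*} [NormedAddCommGroup E] [NormedSpace ℝ E] [FiniteDimensional ℝ E]

/-- One-sided Haar inequality on a cone. -/
theorem nonpos_of_haar_inequality {u : ℝ × E → ℝ} {x₀ : E} {C R : ℝ} (hC : 0 ≤ C)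
    (hd : ∀ q : ℝ × E, 0 ≤ q.1 → C * q.1 + dist q.2 x₀ ≤ R → q.1 ≤ R → DifferentiableAt ℝ u q)
    (h0 : ∀ x, dist x x₀ ≤ R → u (0, x) ≤ 0)
    (hle : ∀ q : ℝ × E, 0 ≤ q.1 → C * q.1 + dist q.2 x₀ ≤ R → q.1 ≤ R →
      fderiv ℝ u q (1, 0) ≤ C * ‖(fderiv ℝ u q).comp (ContinuousLinearMap.inr ℝ ℝ E)‖)
    {q : ℝ × E} (hq0 : 0 ≤ q.1) (hq1 : C * q.1 + dist q.2 x₀ ≤ R) (hq2 : q.1 ≤ R) : u q ≤ 0 := by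
  have := FiniteDimensional.proper ℝ E
  set K : Set (ℝ × E) := {q | 0 ≤ q.1 ∧ C * q.1 + dist q.2 x₀ ≤ R ∧ q.1 ≤ R} with hK
  have hKc : IsCompact K := by
    refine (isCompact_Icc.prod (isCompact_closedBall x₀ R)).of_isClosed_subset
      (s := Icc (0 : ℝ) R ×ˢ closedBall x₀ R) ?_ ?_
    · simp only [hK, ofPred_and]
      refine (isClosed_le continuous_const continuous_fst).inter
        ((isClosed_le ?_ continuous_const).inter (isClosed_le continuous_fst continuous_const))
      fun_prop
    · rintro q ⟨h1, h2, h3⟩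
      exact ⟨⟨h1, h3⟩, by rw [mem_closedBall]; nlinarith⟩
  have hcont : ContinuousOn u K := fun q hq =>
    (hd q hq.1 hq.2.1 hq.2.2).continuousAt.continuousWithinAt
  -- Penalizing time by `δ` makes the inequality strict. At a maximum with positive time, all
  -- directions `(-1, v)` with `‖v‖ ≤ C` point into the cone, so the supremum over `v` gives `C *
  -- ‖dₓu‖ ≤ ∂u/∂h - δ`, contradicting the hypothesis.
  have key : ∀ δ > 0, u q - δ * q.1 ≤ 0 := by
    intro δ hδ
    have hcont' : ContinuousOn (fun q : ℝ × E => u q - δ * q.1) K :=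
      hcont.sub (continuous_const.mul continuous_fst).continuousOn
    obtain ⟨m, hm, hmax⟩ := hKc.exists_isMaxOn ⟨q, hq0, hq1, hq2⟩ hcont'
    refine (hmax ⟨hq0, hq1, hq2⟩).trans ?_
    rcases hm.1.eq_or_lt with hm0 | hm0
    · have h2 := h0 m.2 (by have := hm.2.1; rw [← hm0] at this; simpa using this)
      have h3 : m = (0, m.2) := Prod.ext hm0.symm rfl
      have h4 : u m - δ * m.1 ≤ 0 := by
        rw [← hm0, h3]
        simpa using h2
      exact h4
    · exfalso
      have hdm := (hd m hm.1 hm.2.1 hm.2.2).hasFDerivAt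
      have hdir : ∀ v : E, ‖v‖ ≤ C → fderiv ℝ u m (0, v) ≤ fderiv ℝ u m (1, 0) - δ := by
        intro v hv
        have hl : HasDerivAt (fun τ : ℝ => m + τ • ((-1, v) : ℝ × E)) (-1, v) 0 := by
          simpa using ((hasDerivAt_id (0 : ℝ)).smul_const ((-1, v) : ℝ × E)).const_add m
        have h1 : HasDerivAt (fun τ : ℝ => u (m + τ • ((-1, v) : ℝ × E))
            - δ * (m + τ • ((-1, v) : ℝ × E)).1) (fderiv ℝ u m (-1, v) - δ * (-1)) 0 :=
          (HasFDerivAt.comp_hasDerivAt_of_eq (l := u) (0 : ℝ) hdm hl (by simp)).sub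
            (((hasFDerivAt_fst (𝕜 := ℝ) (E := ℝ) (F := E)).comp_hasDerivAt (0 : ℝ) hl).const_mul δ)
        have h2 : ∀ᶠ τ in 𝓝[>] (0 : ℝ), m + τ • ((-1, v) : ℝ × E) ∈ K := by
          filter_upwards [Ioo_mem_nhdsGT hm0] with τ hτ
          have hτ0 := hτ.1
          have hτ1 := hτ.2
          refine ⟨?_, ?_, ?_⟩
          · simp; linarith
          · have h3 : dist (m.2 + τ • v) x₀ ≤ dist m.2 x₀ + τ * C := by
              rw [dist_eq_norm, dist_eq_norm, add_sub_right_comm]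
              refine (norm_add_le _ _).trans (add_le_add_right ?_ _)
              rw [norm_smul, Real.norm_eq_abs, abs_of_pos hτ0]
              exact mul_le_mul_of_nonneg_left hv hτ0.le
            have h4 := hm.2.1
            simp only [Prod.fst_add, Prod.snd_add, Prod.smul_fst, Prod.smul_snd, smul_eq_mul]
            linarith
          · have := hm.2.2
            simp; linarith
        have h3 : fderiv ℝ u m (-1, v) - δ * (-1) ≤ 0 := by
          refine le_of_tendsto ((hasDerivAt_iff_tendsto_slope.1 h1).mono_left
            (nhdsWithin_mono 0 (s := Ioi 0) fun x hx => (ne_of_gt hx : x ≠ 0))) ?_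
          filter_upwards [h2, self_mem_nhdsWithin] with τ hτ hτ0
          have h4 := hmax hτ
          rw [slope_def_field]
          refine div_nonpos_of_nonpos_of_nonneg ?_ ?_
          · simp only [mem_ofPred_eq, zero_smul, add_zero] at h4 ⊢
            linarith
          · simpa using (le_of_lt hτ0)
        have h4 : ((-1, v) : ℝ × E) = (0, v) - (1, 0) := by simp
        rw [h4, map_sub] at h3
        linarith
      have h5 := hle m hm.1 hm.2.1 hm.2.2
      rcases hC.eq_or_lt with hC0 | hC0
      · have := hdir 0 (by simp [hC])
        rw [← hC0, zero_mul] at h5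
        have h6 : fderiv ℝ u m ((0, 0) : ℝ × E) = 0 := map_zero _
        rw [h6] at this
        linarith
      · set B := fderiv ℝ u m (1, 0) - δ with hB
        have hB0 : 0 ≤ B := by
          have := hdir 0 (by simp [hC])
          have h6 : fderiv ℝ u m ((0, 0) : ℝ × E) = 0 := map_zero _
          rwa [h6] at this
        have h7 : ‖(fderiv ℝ u m).comp (ContinuousLinearMap.inr ℝ ℝ E)‖ ≤ B / C := by
          refine ContinuousLinearMap.opNorm_le_of_unit_norm (by positivity) fun v hv => ?_
          have e1 := hdir (C • v) (by rw [norm_smul, hv, mul_one, Real.norm_eq_abs, abs_of_pos hC0])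
          have e2 := hdir (-(C • v))
            (by rw [norm_neg, norm_smul, hv, mul_one, Real.norm_eq_abs, abs_of_pos hC0])
          have e3 : fderiv ℝ u m (0, C • v) = C * fderiv ℝ u m (0, v) := by
            rw [← smul_eq_mul, ← map_smul]; simp
          have e4 : fderiv ℝ u m (0, -(C • v)) = -(C * fderiv ℝ u m (0, v)) := by
            rw [← e3, ← map_neg]; simp
          rw [e3] at e1
          rw [e4] at e2
          rw [Real.norm_eq_abs, le_div_iff₀ hC0]
          simp only [ContinuousLinearMap.comp_apply, ContinuousLinearMap.inr_apply]
          rw [← abs_of_pos hC0, ← abs_mul, mul_comm]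
          exact abs_le.2 ⟨by linarith, by linarith⟩
        have h8 : C * ‖(fderiv ℝ u m).comp (ContinuousLinearMap.inr ℝ ℝ E)‖ ≤ B := by
          rw [le_div_iff₀ hC0] at h7
          linarith
        linarith
  have hlim : Tendsto (fun δ : ℝ => u q - δ * q.1) (𝓝[>] 0) (𝓝 (u q - 0 * q.1)) :=
    (Continuous.tendsto (by fun_prop) 0).mono_left nhdsWithin_le_nhds
  rw [zero_mul, sub_zero] at hlim
  exact le_of_tendsto hlim (eventually_mem_nhdsWithin.mono fun δ hδ => key δ hδ)

/-- Haar's uniqueness theorem, for the points in the future of the initial surface. -/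
theorem eventually_eq_zero_of_haar_right {u : ℝ × E → ℝ} {x₀ : E} {C : ℝ}
    (hd : ∀ᶠ q in 𝓝 ((0 : ℝ), x₀), DifferentiableAt ℝ u q)
    (h0 : ∀ᶠ x in 𝓝 x₀, u (0, x) = 0)
    (hle : ∀ᶠ q in 𝓝 ((0 : ℝ), x₀),
      |fderiv ℝ u q (1, 0)| ≤ C * ‖(fderiv ℝ u q).comp (ContinuousLinearMap.inr ℝ ℝ E)‖) :
    ∀ᶠ q in 𝓝 ((0 : ℝ), x₀), 0 ≤ q.1 → u q = 0 := by
  obtain ⟨r₁, hr₁, h1⟩ := Metric.eventually_nhds_iff.1 (hd.and hle)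
  obtain ⟨r₂, hr₂, h2⟩ := Metric.eventually_nhds_iff.1 h0
  set R := min r₁ r₂ / 2 with hR
  have hmin : 0 < min r₁ r₂ := lt_min hr₁ hr₂
  have hR0 : 0 < R := by positivity
  have hR1 : R < r₁ := by have := min_le_left r₁ r₂; linarith
  have hR2 : R < r₂ := by have := min_le_right r₁ r₂; linarith
  have hC : 0 ≤ |C| := abs_nonneg C
  have hcone : ∀ q : ℝ × E, 0 ≤ q.1 → |C| * q.1 + dist q.2 x₀ ≤ R → q.1 ≤ R →
      dist q (0, x₀) < r₁ := fun q a b c => by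
    rw [Prod.dist_eq]
    refine max_lt ?_ ?_
    · rw [Real.dist_eq, sub_zero, abs_of_nonneg a]; linarith
    · have := mul_nonneg hC a
      simp only; linarith
  have hle' : ∀ q : ℝ × E, 0 ≤ q.1 → |C| * q.1 + dist q.2 x₀ ≤ R → q.1 ≤ R →
      |fderiv ℝ u q (1, 0)| ≤ |C| * ‖(fderiv ℝ u q).comp (ContinuousLinearMap.inr ℝ ℝ E)‖ :=
    fun q a b c => ((h1 (hcone q a b c)).2).trans
      (mul_le_mul_of_nonneg_right (le_abs_self C) (norm_nonneg _))
  have hmem : ∀ᶠ q : ℝ × E in 𝓝 ((0 : ℝ), x₀), |C| * q.1 + dist q.2 x₀ < R ∧ q.1 < R := by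
    refine (ContinuousAt.eventually_lt (f := fun q : ℝ × E => |C| * q.1 + dist q.2 x₀)
      (by fun_prop) continuousAt_const (by simpa using hR0)).and
      (ContinuousAt.eventually_lt (f := fun q : ℝ × E => q.1) (by fun_prop)
        continuousAt_const (by simpa using hR0))
  filter_upwards [hmem] with q hq hq0
  refine le_antisymm ?_ ?_
  · exact nonpos_of_haar_inequality hC (fun q a b c => (h1 (hcone q a b c)).1)
      (fun x hx => (h2 (hx.trans_lt hR2)).le)
      (fun q a b c => (le_abs_self _).trans (hle' q a b c)) hq0 hq.1.le hq.2.le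
  · have := nonpos_of_haar_inequality (u := fun q => -u q) hC
      (fun q a b c => (h1 (hcone q a b c)).1.fun_neg)
      (fun x hx => by simp [h2 (hx.trans_lt hR2)])
      (fun q a b c => by
        have h3 : fderiv ℝ (fun q => -u q) q = -fderiv ℝ u q := fderiv_fun_neg
        rw [h3, ContinuousLinearMap.neg_comp, norm_neg]
        exact (neg_le_abs _).trans (hle' q a b c)) hq0 hq.1.le hq.2.le
    linarith

/-- Haar's uniqueness theorem: a function which vanishes for `h = 0` and satisfies
`|∂u/∂h| ≤ C ‖du‖` vanishes near `h = 0`. -/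
theorem eventually_eq_zero_of_haar {u : ℝ × E → ℝ} {x₀ : E} {C : ℝ}
    (hd : ∀ᶠ q in 𝓝 ((0 : ℝ), x₀), DifferentiableAt ℝ u q)
    (h0 : ∀ᶠ x in 𝓝 x₀, u (0, x) = 0)
    (hle : ∀ᶠ q in 𝓝 ((0 : ℝ), x₀),
      |fderiv ℝ u q (1, 0)| ≤ C * ‖(fderiv ℝ u q).comp (ContinuousLinearMap.inr ℝ ℝ E)‖) :
    ∀ᶠ q in 𝓝 ((0 : ℝ), x₀), u q = 0 := by
  let ρ : ℝ × E →L[ℝ] ℝ × E :=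
    (-ContinuousLinearMap.fst ℝ ℝ E).prod (ContinuousLinearMap.snd ℝ ℝ E)
  have hρ : Tendsto ρ (𝓝 ((0 : ℝ), x₀)) (𝓝 ((0 : ℝ), x₀)) := by
    have := ρ.continuous.tendsto ((0 : ℝ), x₀)
    simpa [ρ] using this
  have hρρ : ∀ q, ρ (ρ q) = q := fun q => by simp [ρ]
  have hfd : ∀ᶠ q in 𝓝 ((0 : ℝ), x₀), fderiv ℝ (fun q => u (ρ q)) q = (fderiv ℝ u (ρ q)).comp ρ :=
    (hρ.eventually hd).mono fun q hq => (hq.hasFDerivAt.comp q ρ.hasFDerivAt).fderiv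
  have hright := eventually_eq_zero_of_haar_right hd h0 hle
  have hleft := eventually_eq_zero_of_haar_right (u := fun q => u (ρ q)) (C := C)
    ((hρ.eventually hd).mono fun q hq => hq.comp q ρ.differentiableAt)
    (h0.mono fun x hx => by simpa [ρ] using hx) (by
      filter_upwards [hfd, hρ.eventually hle] with q h1 h2
      rw [h1]
      have e1 : ((fderiv ℝ u (ρ q)).comp ρ) (1, 0) = -fderiv ℝ u (ρ q) (1, 0) := by
        rw [← map_neg]; simp [ρ]
      have e2 : ((fderiv ℝ u (ρ q)).comp ρ).comp (ContinuousLinearMap.inr ℝ ℝ E)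
          = (fderiv ℝ u (ρ q)).comp (ContinuousLinearMap.inr ℝ ℝ E) := by
        ext v; simp [ρ]
      rwa [e1, e2, abs_neg])
  filter_upwards [hright, hρ.eventually hleft] with q h1 h2
  rcases le_total 0 q.1 with h | h
  · exact h1 h
  · have := h2 (by simpa [ρ] using h)
    rwa [hρρ] at this

end Haar

end

section

open Filter Metric

/-! ### Solutions of the Hamilton–Jacobi equation -/

variable {n : ℕ} {U : Set (Pt n × Pt n)} {G : Pt n × Pt n → ℝ} {c : ℝ → ℝ}
  {W : Set (ℝ × Pt n)} {S : ℝ → Pt n → ℝ}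

/-- The lift `(h, x) ↦ (x, dS_h(x))`. -/
def lift (S : ℝ → Pt n → ℝ) (q : ℝ × Pt n) : Pt n × Pt n := (q.2, differential (S q.1) q.2)

theorem clm_apply_eq_sum {F : Type*} [NormedAddCommGroup F] [NormedSpace ℝ F]
    (L : Pt n →L[ℝ] F) (v : Pt n) : L v = ∑ i, v i • L (Pi.single i 1) := by
  conv_lhs => rw [pi_eq_sum_univ' v]
  simp [map_sum]

theorem IsHJSolution.contDiffAt (hS : IsHJSolution U G c W S) {q : ℝ × Pt n} (hq : q ∈ W) :
    ContDiffAt ℝ ∞ (fun q : ℝ × Pt n => S q.1 q.2) q :=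
  hS.smooth.contDiffAt (hS.isOpen.mem_nhds hq)

theorem IsHJSolution.hasFDerivAt (hS : IsHJSolution U G c W S) {q : ℝ × Pt n} (hq : q ∈ W) :
    HasFDerivAt (fun q : ℝ × Pt n => S q.1 q.2)
      (fderiv ℝ (fun q : ℝ × Pt n => S q.1 q.2) q) q :=
  ((hS.contDiffAt hq).differentiableAt (by simp)).hasFDerivAt

theorem IsHJSolution.lift_mem (hS : IsHJSolution U G c W S) {q : ℝ × Pt n} (hq : q ∈ W) :
    lift S q ∈ U := hS.mem q.1 q.2 hq

theorem IsHJSolution.differential_eq (hS : IsHJSolution U G c W S) {q : ℝ × Pt n} (hq : q ∈ W) :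
    differential (S q.1) q.2
      = fun i => fderiv ℝ (fun q : ℝ × Pt n => S q.1 q.2) q (0, Pi.single i 1) := by
  funext i
  have h : HasFDerivAt (S q.1) ((fderiv ℝ (fun q : ℝ × Pt n => S q.1 q.2) q).comp
      (ContinuousLinearMap.inr ℝ ℝ (Pt n))) q.2 :=
    HasFDerivAt.comp (g := fun q : ℝ × Pt n => S q.1 q.2) (f := fun x => (q.1, x)) q.2
      (hS.hasFDerivAt hq) (hasFDerivAt_prodMk_right q.1 q.2)
  rw [differential, pderiv, h.fderiv]
  rfl

theorem IsHJSolution.fderiv_time (hS : IsHJSolution U G c W S) {q : ℝ × Pt n} (hq : q ∈ W) :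
    fderiv ℝ (fun q : ℝ × Pt n => S q.1 q.2) q (1, 0) = G (lift S q) + c q.1 := by
  have h1 : HasDerivAt (fun t : ℝ => (t, q.2)) ((1, 0) : ℝ × Pt n) q.1 :=
    (hasDerivAt_id q.1).prodMk (hasDerivAt_const q.1 q.2)
  have h2 : HasDerivAt (fun t => S t q.2)
      (fderiv ℝ (fun q : ℝ × Pt n => S q.1 q.2) q (1, 0)) q.1 :=
    (hS.hasFDerivAt hq).comp_hasDerivAt_of_eq q.1 h1 rfl
  exact h2.unique (hS.eqn q.1 q.2 hq)

theorem IsHJSolution.contDiffAt_fderiv (hS : IsHJSolution U G c W S) {q : ℝ × Pt n}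
    (hq : q ∈ W) : ContDiffAt ℝ ∞ (fderiv ℝ (fun q : ℝ × Pt n => S q.1 q.2)) q :=
  (hS.contDiffAt hq).fderiv_right (by simp)

theorem IsHJSolution.lift_eventuallyEq (hS : IsHJSolution U G c W S) {q : ℝ × Pt n}
    (hq : q ∈ W) : lift S =ᶠ[𝓝 q] fun q =>
      (q.2, fun i => fderiv ℝ (fun q : ℝ × Pt n => S q.1 q.2) q (0, Pi.single i 1)) := by
  filter_upwards [hS.isOpen.mem_nhds hq] with w hw
  rw [lift, hS.differential_eq hw]

theorem IsHJSolution.contDiffAt_lift (hS : IsHJSolution U G c W S) {q : ℝ × Pt n}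
    (hq : q ∈ W) : ContDiffAt ℝ ∞ (lift S) q := by
  refine ContDiffAt.congr_of_eventuallyEq ?_ (hS.lift_eventuallyEq hq)
  exact contDiffAt_snd.prodMk (contDiffAt_pi.2 fun i =>
    (hS.contDiffAt_fderiv hq).clm_apply contDiffAt_const)

theorem IsHJSolution.hasFDerivAt_lift (hS : IsHJSolution U G c W S) {q : ℝ × Pt n}
    (hq : q ∈ W) : HasFDerivAt (lift S) (fderiv ℝ (lift S) q) q :=
  ((hS.contDiffAt_lift hq).differentiableAt (by simp)).hasFDerivAt

theorem IsHJSolution.fderiv_lift_apply (hS : IsHJSolution U G c W S) {q : ℝ × Pt n}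
    (hq : q ∈ W) (k : ℝ × Pt n) : fderiv ℝ (lift S) q k = (k.2, fun i =>
      fderiv ℝ (fderiv ℝ (fun q : ℝ × Pt n => S q.1 q.2)) q k (0, Pi.single i 1)) := by
  have hd : HasFDerivAt (fderiv ℝ (fun q : ℝ × Pt n => S q.1 q.2))
      (fderiv ℝ (fderiv ℝ (fun q : ℝ × Pt n => S q.1 q.2)) q) q :=
    ((hS.contDiffAt_fderiv hq).differentiableAt (by simp)).hasFDerivAt
  have h : HasFDerivAt (fun q : ℝ × Pt n => ((q.2, fun i =>
      fderiv ℝ (fun q : ℝ × Pt n => S q.1 q.2) q (0, Pi.single i 1)) : Pt n × Pt n))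
      ((ContinuousLinearMap.snd ℝ ℝ (Pt n)).prod (ContinuousLinearMap.pi fun i =>
        (fderiv ℝ (fderiv ℝ (fun q : ℝ × Pt n => S q.1 q.2)) q).flip (0, Pi.single i 1))) q := by
    refine hasFDerivAt_snd.prodMk (hasFDerivAt_pi.2 fun i => ?_)
    simpa using hd.clm_apply (hasFDerivAt_const ((0, Pi.single i 1) : ℝ × Pt n) q)
  rw [(hS.lift_eventuallyEq hq).fderiv_eq, h.fderiv]
  rfl

/-- The differential in `x` of the Hamilton–Jacobi equation. -/
theorem IsHJSolution.fderiv_fderiv_time (hS : IsHJSolution U G c W S)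
    (hG : ∀ z ∈ U, ContDiffAt ℝ ∞ G z) {q : ℝ × Pt n} (hq : q ∈ W) (v : Pt n) :
    fderiv ℝ (fderiv ℝ (fun q : ℝ × Pt n => S q.1 q.2)) q (0, v) (1, 0)
      = fderiv ℝ G (lift S q) (fderiv ℝ (lift S) q (0, v)) := by
  have hd : HasFDerivAt (fderiv ℝ (fun q : ℝ × Pt n => S q.1 q.2))
      (fderiv ℝ (fderiv ℝ (fun q : ℝ × Pt n => S q.1 q.2)) q) q :=
    ((hS.contDiffAt_fderiv hq).differentiableAt (by simp)).hasFDerivAt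
  have hGd : HasFDerivAt G (fderiv ℝ G (lift S q)) (lift S q) :=
    ((hG _ (hS.lift_mem hq)).differentiableAt (by simp)).hasFDerivAt
  have hl : HasDerivAt (fun τ : ℝ => q + τ • ((0, v) : ℝ × Pt n)) (0, v) 0 := by
    simpa using ((hasDerivAt_id (0 : ℝ)).smul_const ((0, v) : ℝ × Pt n)).const_add q
  have h1 : HasDerivAt (fun τ : ℝ => fderiv ℝ (fun q : ℝ × Pt n => S q.1 q.2)
      (q + τ • ((0, v) : ℝ × Pt n)) (1, 0))
      (fderiv ℝ (fderiv ℝ (fun q : ℝ × Pt n => S q.1 q.2)) q (0, v) (1, 0)) 0 := by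
    have h2 := HasFDerivAt.comp_hasDerivAt_of_eq (0 : ℝ) hd hl (by simp)
    simpa using h2.clm_apply (hasDerivAt_const (0 : ℝ) ((1, 0) : ℝ × Pt n))
  -- The direction `(0, v)` keeps the time fixed, so `c` enters only as a constant and its
  -- regularity does not matter.
  have h3 : HasDerivAt (fun τ : ℝ => G (lift S (q + τ • ((0, v) : ℝ × Pt n))) + c q.1)
      (fderiv ℝ G (lift S q) (fderiv ℝ (lift S) q (0, v))) 0 := by
    have h4 : HasDerivAt (fun τ : ℝ => lift S (q + τ • ((0, v) : ℝ × Pt n)))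
        (fderiv ℝ (lift S) q (0, v)) 0 :=
      HasFDerivAt.comp_hasDerivAt_of_eq (l := lift S) (0 : ℝ) (hS.hasFDerivAt_lift hq) hl (by simp)
    exact (HasFDerivAt.comp_hasDerivAt_of_eq (l := G) (0 : ℝ) hGd h4 (by simp)).add_const _
  refine h1.unique (h3.congr_of_eventuallyEq ?_)
  have hW : ∀ᶠ τ in 𝓝 (0 : ℝ), q + τ • ((0, v) : ℝ × Pt n) ∈ W :=
    hl.continuousAt.eventually (by simpa using hS.isOpen.mem_nhds hq)
  filter_upwards [hW] with τ hτ
  rw [hS.fderiv_time hτ]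
  simp

/-- The Hamiltonian vector field is tangent to the lift of a solution. -/
theorem IsHJSolution.fderiv_lift_hamiltonianField (hS : IsHJSolution U G c W S)
    (hG : ∀ z ∈ U, ContDiffAt ℝ ∞ G z) {q : ℝ × Pt n} (hq : q ∈ W) :
    fderiv ℝ (lift S) q (1, (hamiltonianField G (lift S q)).1)
      = hamiltonianField G (lift S q) := by
  set D := fderiv ℝ (fderiv ℝ (fun q : ℝ × Pt n => S q.1 q.2)) q with hD
  set X := hamiltonianField G (lift S q) with hX
  -- Symmetry of the Hessian turns the derivative of `dS` along the curve into the `x`-derivative of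
  -- the equation; the terms in which `G` is differentiated in the momenta then cancel against
  -- transport by `X.1`.
  have hsymm : ∀ a b, D a b = D b a := fun a b =>
    (((contDiffAt_infty.1 (hS.contDiffAt hq)) 2).isSymmSndFDerivAt (by simp)) a b
  rw [hS.fderiv_lift_apply hq, ← hD]
  refine Prod.ext rfl (funext fun i => ?_)
  have h1 : ((1, X.1) : ℝ × Pt n) = (1, 0) + (0, X.1) := by simp
  have h2 : D (0, Pi.single i 1) (1, 0) = fderiv ℝ G (lift S q) (Pi.single i 1, 0)
      + fderiv ℝ G (lift S q) (0, fun k => D (0, Pi.single i 1) (0, Pi.single k 1)) := by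
    rw [hD, hS.fderiv_fderiv_time hG hq, hS.fderiv_lift_apply hq, ← map_add]
    simp
  have h3 : D (0, Pi.single i 1) (0, X.1)
      = -fderiv ℝ G (lift S q) (0, fun k => D (0, Pi.single i 1) (0, Pi.single k 1)) := by
    have e1 := clm_apply_eq_sum ((D (0, Pi.single i 1)).comp
      (ContinuousLinearMap.inr ℝ ℝ (Pt n))) X.1
    have e2 := clm_apply_eq_sum ((fderiv ℝ G (lift S q)).comp
      (ContinuousLinearMap.inr ℝ (Pt n) (Pt n)))
      (fun k => D (0, Pi.single i 1) (0, Pi.single k 1))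
    simp only [ContinuousLinearMap.comp_apply, ContinuousLinearMap.inr_apply] at e1 e2
    rw [e1, e2, ← Finset.sum_neg_distrib]
    refine Finset.sum_congr rfl fun k _ => ?_
    simp only [hX, hamiltonianField, smul_eq_mul]
    ring
  change D (1, X.1) (0, Pi.single i 1) = X.2 i
  rw [hsymm, h1, map_add, h2, h3]
  simp [hX, hamiltonianField]

theorem contDiffAt_hamiltonianField {z : Pt n × Pt n} (hG : ContDiffAt ℝ ∞ G z) :
    ContDiffAt ℝ ∞ (hamiltonianField G) z := by
  have h : ContDiffAt ℝ ∞ (fderiv ℝ G) z := hG.fderiv_right (by simp)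
  exact (contDiffAt_pi.2 fun i => (h.clm_apply contDiffAt_const).neg).prodMk
    (contDiffAt_pi.2 fun i => h.clm_apply contDiffAt_const)

theorem IsHJSolution.lift_zero (hS : IsHJSolution U G c W S) (x : Pt n) :
    lift S (0, x) = (x, 0) := by
  have h : S 0 = fun _ => 0 := funext hS.initial
  refine Prod.ext rfl (funext fun i => ?_)
  simp [lift, differential, pderiv, h]

/-- The method of characteristics: Hamiltonian trajectories which start on the zero section stay
on the graph of `dS_h`. -/
theorem IsHJSolution.eq_lift_of_isIntegralCurveOn (hS : IsHJSolution U G c W S)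
    (hG : ∀ z ∈ U, ContDiffAt ℝ ∞ G z) {γ : ℝ → Pt n × Pt n} {h : ℝ}
    (h0 : (γ 0).2 = 0) (hγU : ∀ t ∈ Icc 0 h, γ t ∈ U)
    (hγ : IsIntegralCurveOn γ (fun _ => hamiltonianField G) (Icc 0 h))
    (hγW : ∀ t ∈ Icc 0 h, (t, (γ t).1) ∈ W) {t : ℝ} (ht : t ∈ Icc 0 h) :
    lift S (t, (γ t).1) = γ t := by
  set X := hamiltonianField G with hX
  have hq : ∀ t ∈ Icc 0 h, HasDerivWithinAt (fun t => (t, (γ t).1)) ((1, (X (γ t)).1) : ℝ × Pt n)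
      (Icc 0 h) t := fun t ht =>
    (hasDerivWithinAt_id t _).prodMk
      ((hasFDerivAt_fst (𝕜 := ℝ) (E := Pt n) (F := Pt n)).comp_hasDerivWithinAt t (hγ t ht))
  have hqc : ContinuousOn (fun t => (t, (γ t).1)) (Icc 0 h) := fun t ht =>
    (hq t ht).continuousWithinAt
  have hlc : ContinuousOn (fun t => lift S (t, (γ t).1)) (Icc 0 h) := fun t ht =>
    ContinuousAt.comp_continuousWithinAt (f := fun t => (t, (γ t).1))
      (hS.contDiffAt_lift (hγW t ht)).continuousAt (hqc t ht)
  -- Tangency of the field to the lift makes this derivative a combination of differences of `X` at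
  -- `γ t` and at its candidate. With `X` locally Lipschitz, Gronwall propagates the equality to the
  -- right of any time where it holds.
  have hδ : ∀ t ∈ Icc 0 h, HasDerivWithinAt (fun t => lift S (t, (γ t).1) - γ t)
      ((X (lift S (t, (γ t).1)) - X (γ t))
        + fderiv ℝ (lift S) (t, (γ t).1) (0, (X (γ t) - X (lift S (t, (γ t).1))).1))
      (Icc 0 h) t := by
    intro t ht
    have h1 := (hS.hasFDerivAt_lift (hγW t ht)).comp_hasDerivWithinAt t (hq t ht)
    refine (h1.fun_sub (hγ t ht)).congr_deriv ?_
    have h2 := hS.fderiv_lift_hamiltonianField hG (hγW t ht)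
    rw [← hX] at h2
    have h3 : ((1, (X (γ t)).1) : ℝ × Pt n) = (1, (X (lift S (t, (γ t).1))).1)
        + (0, (X (γ t) - X (lift S (t, (γ t).1))).1) := by simp
    rw [h3, map_add, h2]
    abel
  have hclosed : IsClosed ({t | lift S (t, (γ t).1) = γ t} ∩ Icc 0 h) := by
    have := (hlc.sub hγ.continuousOn).preimage_isClosed_of_isClosed isClosed_Icc
      (isClosed_singleton (x := (0 : Pt n × Pt n)))
    convert this using 1
    ext t
    simp [sub_eq_zero, and_comm]
  refine hclosed.Icc_subset_of_forall_mem_nhdsWithin ?_ ?_ ht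
  · change lift S (0, (γ 0).1) = γ 0
    rw [hS.lift_zero]
    exact Prod.ext rfl h0.symm
  rintro t ⟨hts, htI⟩
  replace hts : lift S (t, (γ t).1) = γ t := hts
  have htI' := Ico_subset_Icc_self htI
  obtain ⟨K, V, hV, hK⟩ := ((contDiffAt_hamiltonianField
    (hG _ (hγU t htI'))).of_le (n := ∞) (m := 1) (by simp)).exists_lipschitzOnWith
  have hNc : ContinuousAt (fun q => ‖fderiv ℝ (lift S) q‖) (t, (γ t).1) :=
    (((hS.contDiffAt_lift (hγW t htI')).fderiv_right (m := ∞) (by simp)).continuousAt).norm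
  set N := ‖fderiv ℝ (lift S) (t, (γ t).1)‖ + 1 with hN
  have hNev : ∀ᶠ q in 𝓝 (t, (γ t).1), ‖fderiv ℝ (lift S) q‖ < N :=
    hNc.eventually_lt continuousAt_const (by simp [hN])
  have hev : ∀ᶠ s in 𝓝[Icc 0 h] t, γ s ∈ V ∧ lift S (s, (γ s).1) ∈ V ∧
      ‖fderiv ℝ (lift S) (s, (γ s).1)‖ < N := by
    refine ((hγ.continuousOn t htI').eventually hV).and
      (((hlc t htI').eventually ?_).and ((hqc t htI').eventually hNev))
    simp only [hts]
    exact hV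
  have hev' : ∀ᶠ s in 𝓝[≥] t, s ∈ Icc 0 h ∧ γ s ∈ V ∧ lift S (s, (γ s).1) ∈ V ∧
      ‖fderiv ℝ (lift S) (s, (γ s).1)‖ < N := by
    have hle : 𝓝[≥] t ≤ 𝓝[Icc 0 h] t := le_inf nhdsWithin_le_nhds (le_principal_iff.2
      (mem_of_superset (Icc_mem_nhdsGE htI.2) (Icc_subset_Icc_left htI.1)))
    exact (eventually_mem_nhdsWithin.filter_mono hle).and (hev.filter_mono hle)
  obtain ⟨u, hu, hsub⟩ := (mem_nhdsGE_iff_exists_Icc_subset).1 hev'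
  have hIcc : Icc t u ⊆ Icc 0 h := fun s hs => (hsub hs).1
  have hz := eq_zero_of_abs_deriv_le_mul_abs_self_of_eq_zero_right
    (f := fun t => lift S (t, (γ t).1) - γ t) (a := t) (b := u) (K := (1 + N) * K)
    (fun s hs => ((hδ s (hIcc hs)).continuousWithinAt).mono hIcc)
    (fun s hs => hasDerivWithinAt_Ici_of_Icc hs
      ((hδ s (hIcc (Ico_subset_Icc_self hs))).mono hIcc)) (by simp [hts])
    (fun s hs => by
      obtain ⟨-, h1, h2, h3⟩ := hsub (Ico_subset_Icc_self hs)
      have h4 := hK.dist_le_mul _ h2 _ h1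
      rw [dist_eq_norm, dist_eq_norm] at h4
      refine (norm_add_le _ _).trans ?_
      have h5 : ‖fderiv ℝ (lift S) (s, (γ s).1)
          (0, (X (γ s) - X (lift S (s, (γ s).1))).1)‖
          ≤ N * ‖X (lift S (s, (γ s).1)) - X (γ s)‖ := by
        refine (ContinuousLinearMap.le_opNorm _ _).trans (mul_le_mul h3.le ?_ (norm_nonneg _)
          ((norm_nonneg _).trans h3.le))
        rw [norm_sub_rev, Prod.norm_def]
        simpa using norm_fst_le (X (γ s) - X (lift S (s, (γ s).1)))
      have hN0 : 0 ≤ N := (norm_nonneg _).trans h3.le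
      calc _ ≤ (1 + N) * ‖X (lift S (s, (γ s).1)) - X (γ s)‖ := by linarith
        _ ≤ (1 + N) * (K * ‖lift S (s, (γ s).1) - γ s‖) :=
          mul_le_mul_of_nonneg_left h4 (by linarith)
        _ = _ := by ring)
  exact mem_of_superset (Icc_mem_nhdsGT hu) fun s hs => sub_eq_zero.1 (hz s hs)

end

section

open Filter Metric

/-! ### Oddness of the generating function -/

variable {n : ℕ} {U D : Set (Pt n × Pt n)} {G : Pt n × Pt n → ℝ} {c : ℝ → ℝ}
  {W : Set (ℝ × Pt n)} {S : ℝ → Pt n → ℝ}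

/-- The time reversal `(h, x) ↦ (-h, x)`. -/
def timeReflect (n : ℕ) : ℝ × Pt n →L[ℝ] ℝ × Pt n :=
  (-ContinuousLinearMap.fst ℝ ℝ (Pt n)).prod (ContinuousLinearMap.snd ℝ ℝ (Pt n))

theorem timeReflect_apply (q : ℝ × Pt n) : timeReflect n q = (-q.1, q.2) := rfl

theorem tendsto_timeReflect (x : Pt n) :
    Tendsto (timeReflect n) (𝓝 (0, x)) (𝓝 (0, x)) := by
  have := (timeReflect n).continuous.tendsto (0, x)
  simpa [timeReflect_apply] using this

theorem defect_zero_section (x : Pt n) : defect G (x, 0) = 0 := by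
  simp [defect, reflect]

theorem differentiableAt_defect (hsymm : ∀ z ∈ U, reflect z ∈ U)
    (hG : ∀ z ∈ U, ContDiffAt ℝ ∞ G z) {z : Pt n × Pt n} (hz : z ∈ U) :
    DifferentiableAt ℝ (defect G) z :=
  ((hG z hz).differentiableAt (by simp)).fun_sub
    (((hG _ (hsymm z hz)).comp z contDiff_reflect.contDiffAt).differentiableAt (by simp))

/-- Near time zero, the lift of a solution lies in the zero set of `G - G ∘ reflect`, if these
functions commute near the zero section. -/
theorem IsHJSolution.eventually_defect_lift_eq_zero (hS : IsHJSolution U G c W S)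
    (hsymm : ∀ z ∈ U, reflect z ∈ U) (hG : ∀ z ∈ U, ContDiffAt ℝ ∞ G z) (hDo : IsOpen D)
    (hD0 : ∀ x, (x, 0) ∈ D)
    (hcomm : ∀ z ∈ D, fderiv ℝ (defect G) z (hamiltonianField G z) = 0) (x : Pt n) :
    ∀ᶠ q in 𝓝 ((0 : ℝ), x), defect G (lift S q) = 0 := by
  have hW : ∀ᶠ q in 𝓝 ((0 : ℝ), x), q ∈ W := hS.isOpen.mem_nhds (hS.zero_mem x)
  have hlift := (hS.contDiffAt_lift (hS.zero_mem x)).continuousAt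
  have hDev : ∀ᶠ q in 𝓝 ((0 : ℝ), x), lift S q ∈ D := by
    refine hlift.eventually ?_
    rw [hS.lift_zero]
    exact hDo.mem_nhds (hD0 x)
  have hXc : ContinuousAt (fun q => ‖(hamiltonianField G (lift S q)).1‖) (0, x) := by
    have h1 : ContinuousAt (hamiltonianField G) (lift S (0, x)) :=
      (contDiffAt_hamiltonianField (hG _ (hS.lift_mem (hS.zero_mem x)))).continuousAt
    exact (continuous_fst.continuousAt.comp
      (ContinuousAt.comp (g := hamiltonianField G) (f := lift S) h1 hlift)).norm
  obtain ⟨C, hC⟩ : ∃ C, ∀ᶠ q in 𝓝 ((0 : ℝ), x), ‖(hamiltonianField G (lift S q)).1‖ < C :=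
    ⟨_, hXc.eventually_lt continuousAt_const (lt_add_one _)⟩
  have hu : ∀ q ∈ W, HasFDerivAt (fun q => defect G (lift S q))
      ((fderiv ℝ (defect G) (lift S q)).comp (fderiv ℝ (lift S) q)) q := fun q hq =>
    HasFDerivAt.comp q (differentiableAt_defect hsymm hG (hS.lift_mem hq)).hasFDerivAt
      (hS.hasFDerivAt_lift hq)
  refine eventually_eq_zero_of_haar (C := C) (hW.mono fun q hq => (hu q hq).differentiableAt)
    (Eventually.of_forall fun y => by rw [hS.lift_zero, defect_zero_section]) ?_
  filter_upwards [hW, hDev, hC] with q hq hqD hqC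
  rw [(hu q hq).fderiv]
  set L := (fderiv ℝ (defect G) (lift S q)).comp (fderiv ℝ (lift S) q) with hL
  set X := hamiltonianField G (lift S q) with hX
  -- `(1, X.1)` lifts to the Hamiltonian vector, along which the defect is constant. So the time
  -- derivative equals minus a derivative in the direction `X.1`, which is the inequality Haar's
  -- theorem needs.
  have h1 : L (1, X.1) = 0 := by
    rw [hL, ContinuousLinearMap.comp_apply, hX, hS.fderiv_lift_hamiltonianField hG hq]
    exact hcomm _ hqD
  have h2 : ((1, X.1) : ℝ × Pt n) = (1, 0) + (0, X.1) := by simp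
  have h3 : L (1, 0) = -(L.comp (ContinuousLinearMap.inr ℝ ℝ (Pt n))) X.1 := by
    rw [h2, map_add] at h1
    exact eq_neg_of_add_eq_zero_left h1
  rw [h3, abs_neg, ← Real.norm_eq_abs, mul_comm]
  exact (ContinuousLinearMap.le_opNorm _ _).trans
    (mul_le_mul_of_nonneg_left hqC.le (norm_nonneg _))

/-- The sum of `S` and its time reversal vanishes at `h = 0`. Vanishing of the defect turns its time
derivative into a difference of values of `G` at two covectors over `x`, whose difference is the
`x`-differential of the sum; local Lipschitz continuity of `G` gives Haar's inequality. -/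
theorem IsHJSolution.eventually_odd (hS : IsHJSolution U G c W S) (hc : ∀ h, c (-h) = c h)
    (hsymm : ∀ z ∈ U, reflect z ∈ U) (hG : ∀ z ∈ U, ContDiffAt ℝ ∞ G z) (hDo : IsOpen D)
    (hD0 : ∀ x, (x, 0) ∈ D)
    (hcomm : ∀ z ∈ D, fderiv ℝ (defect G) z (hamiltonianField G z) = 0) (x : Pt n) :
    ∀ᶠ q in 𝓝 ((0 : ℝ), x), S (-q.1) q.2 = -S q.1 q.2 := by
  have hρ := tendsto_timeReflect x
  have hW : ∀ᶠ q in 𝓝 ((0 : ℝ), x), q ∈ W := hS.isOpen.mem_nhds (hS.zero_mem x)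
  have hlift := (hS.contDiffAt_lift (hS.zero_mem x)).continuousAt
  have hdef := hS.eventually_defect_lift_eq_zero hsymm hG hDo hD0 hcomm x
  obtain ⟨K, V, hV, hK⟩ := ((hG _ (hS.lift_mem (hS.zero_mem x))).of_le (n := ∞) (m := 1)
    (by simp)).exists_lipschitzOnWith
  have hV1 : ∀ᶠ q in 𝓝 ((0 : ℝ), x), lift S q ∈ V := hlift.eventually hV
  have hV2 : ∀ᶠ q in 𝓝 ((0 : ℝ), x), reflect (lift S (timeReflect n q)) ∈ V := by
    have h1 : Tendsto (fun q => reflect (lift S (timeReflect n q))) (𝓝 (0, x))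
        (𝓝 (reflect (lift S (0, x)))) :=
      (contDiff_reflect.continuous.tendsto _).comp (hlift.tendsto.comp hρ)
    refine h1.eventually ?_
    have h2 : reflect (lift S (0, x)) = lift S (0, x) := by simp [hS.lift_zero, reflect]
    rw [h2]
    exact hV
  set f : ℝ × Pt n → ℝ := fun q => S q.1 q.2 with hf
  have hw : ∀ q ∈ W, timeReflect n q ∈ W → HasFDerivAt (fun q => f q + f (timeReflect n q))
      (fderiv ℝ f q + (fderiv ℝ f (timeReflect n q)).comp (timeReflect n)) q := fun q h1 h2 =>
    (hS.hasFDerivAt h1).add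
      (HasFDerivAt.comp (g := f) q (hS.hasFDerivAt h2) (timeReflect n).hasFDerivAt)
  have hzero : ∀ᶠ q in 𝓝 ((0 : ℝ), x), f q + f (timeReflect n q) = 0 := by
    refine eventually_eq_zero_of_haar (C := K) ?_
      (Eventually.of_forall fun y => by simp [hf, timeReflect_apply, hS.initial]) ?_
    · filter_upwards [hW, hρ.eventually hW] with q h1 h2
      exact (hw q h1 h2).differentiableAt
    filter_upwards [hW, hρ.eventually hW, hρ.eventually hdef, hV1, hV2] with q h1 h2 h3 h4 h5
    rw [(hw q h1 h2).fderiv]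
    set L := fderiv ℝ f q + (fderiv ℝ f (timeReflect n q)).comp (timeReflect n) with hL
    have e1 : L (1, 0) = G (lift S q) - G (reflect (lift S (timeReflect n q))) := by
      have a : timeReflect n ((1, 0) : ℝ × Pt n) = -(1, 0) := by simp [timeReflect_apply]
      rw [hL, add_apply, ContinuousLinearMap.comp_apply, a, map_neg, hS.fderiv_time h1,
        hS.fderiv_time h2, timeReflect_apply, hc, ← timeReflect_apply]
      rw [defect] at h3
      linarith
    have e2 : ∀ i, L (0, Pi.single i 1)
        = (lift S q - reflect (lift S (timeReflect n q))).2 i := fun i => by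
      have a : timeReflect n ((0, Pi.single i 1) : ℝ × Pt n) = (0, Pi.single i 1) := by
        simp [timeReflect_apply]
      rw [hL, add_apply, ContinuousLinearMap.comp_apply, a]
      simp only [lift, reflect, hS.differential_eq h1, hS.differential_eq h2, Prod.snd_sub,
        Pi.sub_apply, Pi.neg_apply, sub_neg_eq_add, hf]
    have h6 := hK.dist_le_mul _ h4 _ h5
    rw [Real.dist_eq, ← e1] at h6
    refine h6.trans (mul_le_mul_of_nonneg_left ?_ K.2)
    rw [dist_eq_norm, Prod.norm_def]
    refine max_le ?_ ((pi_norm_le_iff_of_nonneg (norm_nonneg _)).2 fun i => ?_)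
    · have : (lift S q - reflect (lift S (timeReflect n q))).1 = 0 := by
        simp [lift, reflect, timeReflect_apply]
      rw [this, norm_zero]
      exact norm_nonneg _
    · rw [← e2]
      refine ((L.comp (ContinuousLinearMap.inr ℝ ℝ (Pt n))).le_opNorm (Pi.single i 1)).trans ?_
      simp [Pi.norm_single]
  filter_upwards [hzero] with q hq
  simp only [hf, timeReflect_apply] at hq
  linarith

/-- The exact generating function is odd. -/
theorem IsHJSolution.odd_of_exact (hS : IsHJSolution U G c W S) (hc : ∀ h, c (-h) = c h)
    (hsymm : ∀ z ∈ U, reflect z ∈ U) (hG : ∀ z ∈ U, ContDiffAt ℝ ∞ G z) (hDo : IsOpen D)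
    (hD0 : ∀ x, (x, 0) ∈ D) (hDcl : ∀ z ∈ U, z ∈ closure D → z ∈ D)
    (hcomm : ∀ z ∈ D, fderiv ℝ (defect G) z (hamiltonianField G z) = 0) {r : ℝ}
    (hrW : Ioo (-r) r ×ˢ univ ⊆ W)
    (hex : ∀ h ∈ Ioo (-r) r, graphDifferential (S h) = flowOfZeroSection U G h)
    {h : ℝ} (hh : h ∈ Ioo (-r) r) (x : Pt n) : S (-h) x = -S h x := by
  have hr : 0 < r := by linarith [hh.1, hh.2]
  have hW : ∀ {h}, h ∈ Ioo (-r) r → ∀ x, (h, x) ∈ W := fun hh x => hrW ⟨hh, mem_univ x⟩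
  have hneg : ∀ {h}, h ∈ Ioo (-r) r → -h ∈ Ioo (-r) r := fun hh =>
    ⟨by linarith [hh.2], by linarith [hh.1]⟩
  have hcurve : ∀ h ∈ Ioo (-r) r, ∀ x, lift S (h, x) ∈ flowOfZeroSection U G h :=
    fun h hh x => by
      rw [← hex h hh]
      exact (rfl : (lift S (h, x)).2 = differential (S h) x)
  have hdef : ∀ h ∈ Ioo (-r) r, ∀ x, defect G (lift S (h, x)) = 0 := by
    intro h hh x
    obtain ⟨γ, h0, hγU, hγ, hγh⟩ := hcurve h hh x
    -- The trajectory is connected, lies in `U` and starts in `D`, which is open and relatively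
    -- closed in `U`.
    have hγD : γ '' uIcc 0 h ⊆ D := by
      refine (isPreconnected_uIcc.image γ hγ.continuousOn).subset_of_closure_inter_subset hDo
        ⟨γ 0, ⟨0, left_mem_uIcc, rfl⟩, ?_⟩ ?_
      · have : γ 0 = ((γ 0).1, 0) := Prod.ext rfl h0
        rw [this]
        exact hD0 _
      · rintro _ ⟨hcl, t, ht, rfl⟩
        exact hDcl _ (hγU t ht) hcl
    have hd : ∀ t ∈ uIcc 0 h, HasDerivWithinAt (fun t => defect G (γ t)) 0 (uIcc 0 h) t :=
      fun t ht => by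
        have h1 := (differentiableAt_defect hsymm hG (hγU t ht)).hasFDerivAt.comp_hasDerivWithinAt
          t (hγ t ht)
        exact h1.congr_deriv (hcomm _ (hγD ⟨t, ht, rfl⟩))
    have h1 := (convex_uIcc 0 h).norm_image_sub_le_of_norm_hasDerivWithin_le (C := 0) hd
      (fun t _ => by simp) left_mem_uIcc right_mem_uIcc
    have h2 : defect G (γ 0) = 0 := by
      have : γ 0 = ((γ 0).1, 0) := Prod.ext rfl h0
      rw [this, defect_zero_section]
    rw [zero_mul, norm_le_zero_iff, h2, sub_zero, hγh] at h1
    exact h1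
  have hdiffT : ∀ t x, differential (fun x => -S (-t) x) x = -differential (S (-t)) x := by
    intro t x
    funext i
    simp [differential, pderiv, fderiv_fun_neg]
  have hT : IsHJSolution U G c (Ioo (-r) r ×ˢ univ) fun t x => -S (-t) x := by
    refine ⟨isOpen_Ioo.prod isOpen_univ, fun x => ⟨⟨by linarith, hr⟩, mem_univ x⟩, ?_,
      fun x => by simp [hS.initial], fun t x ht => ?_, fun t x ht => ?_⟩
    · refine ContDiffOn.neg (hS.smooth.comp (timeReflect n).contDiff.contDiffOn ?_)
      exact fun q hq => hW (hneg hq.1) q.2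
    · rw [hdiffT]
      exact hsymm _ (hS.mem (-t) x (hW (hneg ht.1) x))
    · have h1 := hS.eqn (-t) x (hW (hneg ht.1) x)
      have h2 := ((h1.scomp t (hasDerivAt_neg t))).fun_neg
      refine h2.congr_deriv ?_
      have h3 := hdef (-t) (hneg ht.1) x
      rw [defect, sub_eq_zero] at h3
      rw [hdiffT, hc]
      simp only [neg_smul, one_smul, neg_neg]
      congr 1
  -- The trajectory that reaches `(x, dS_h(x))` is also a characteristic of the reversed solution,
  -- so it ends on the graph of that solution's differential too.
  have hdiff : ∀ h ∈ Ioo (-r) r, 0 ≤ h → ∀ x,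
      differential (S (-h)) x = -differential (S h) x := by
    intro h hh hpos x
    obtain ⟨γ, h0, hγU, hγ, hγh⟩ := hcurve h hh x
    rw [uIcc_of_le hpos] at hγU hγ
    have h1 := hT.eq_lift_of_isIntegralCurveOn hG h0 hγU hγ
      (fun t ht => ⟨⟨by linarith [ht.1], ht.2.trans_lt hh.2⟩, mem_univ _⟩)
      (right_mem_Icc.2 hpos)
    rw [hγh] at h1
    have h2 := congrArg Prod.snd h1
    simp only [lift] at h2
    rw [hdiffT] at h2
    rw [← h2, neg_neg]
  -- Equal differentials give equal right sides of the two evolution equations; as the initial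
  -- values agree, no additive constant is left.
  have hodd : ∀ h ∈ Ioo (-r) r, 0 ≤ h → ∀ x, S (-h) x = -S h x := by
    intro h hh hpos x
    have hd : ∀ t ∈ Icc 0 h, HasDerivWithinAt (fun t => S t x - -S (-t) x) 0 (Icc 0 h) t := by
      intro t ht
      have htr : t ∈ Ioo (-r) r := ⟨by linarith [ht.1], ht.2.trans_lt hh.2⟩
      refine (((hS.eqn t x (hW htr x)).fun_sub
        (hT.eqn t x ⟨htr, mem_univ x⟩)).congr_deriv ?_).hasDerivWithinAt
      rw [hdiffT, hdiff t htr ht.1, neg_neg, sub_self]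
    have h1 := (convex_Icc 0 h).norm_image_sub_le_of_norm_hasDerivWithin_le (C := 0) hd
      (fun t _ => by simp) (left_mem_Icc.2 hpos) (right_mem_Icc.2 hpos)
    simp only [zero_mul, norm_le_zero_iff, neg_zero, hS.initial, sub_neg_eq_add,
      sub_zero] at h1
    linarith
  rcases le_total 0 h with hpos | hpos
  · exact hodd h hh hpos x
  · have := hodd (-h) (hneg hh) (by linarith) x
    rw [neg_neg] at this
    linarith

/-- The even Taylor coefficients of a function that is odd near `h = 0` vanish. -/
theorem coeff_eq_zero_of_even {x : Pt n} (h : ∀ᶠ t in 𝓝 (0 : ℝ), S (-t) x = -S t x) {l : ℕ}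
    (hl : Even l) : coeff S l x = 0 := by
  have h1 : (fun t => S (-t) x) =ᶠ[𝓝 0] fun t => -S t x := h
  have h2 := h1.iteratedDeriv_eq l
  rw [iteratedDeriv_comp_neg l (fun t => S t x), iteratedDeriv_fun_neg, hl.neg_one_pow, one_smul,
    neg_zero] at h2
  have h3 : iteratedDeriv l (fun t => S t x) 0 = 0 := by linarith
  rw [coeff, h3, zero_div]

theorem truncation_eq_sum_odd (h : ∀ l x, Even l → coeff S l x = 0) (m : ℕ) (t : ℝ) (x : Pt n) :
    truncation S m t x
      = ∑ l ∈ (Finset.range (m + 1)).filter Odd, coeff S l x * t ^ l := by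
  rw [truncation, Finset.sum_filter]
  refine Finset.sum_congr rfl fun l _ => ?_
  split_ifs with hl
  · rfl
  · rw [h l x (Nat.not_odd_iff_even.1 hl), zero_mul]

end

end Karasev

end

/-! ### The main theorem -/

theorem mainTheorem3 {n : ℕ} (π : Karasev.Pt n → Matrix (Fin n) (Fin n) ℝ)
    (hπ : Karasev.IsPoissonTensor π) (H : Karasev.Pt n → ℝ) (hH : ContDiff ℝ ∞ H)
    (ε : ℝ) (hε : 0 ≤ ε)
    (U : Set (Karasev.Pt n × Karasev.Pt n)) (α : Karasev.Pt n × Karasev.Pt n → Karasev.Pt n)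
    (hα : Karasev.IsKarasevMap π ε U α)
    (c : ℝ → ℝ) (hc : ∀ h, c (-h) = c h)
    (W : Set (ℝ × Karasev.Pt n)) (S : ℝ → Karasev.Pt n → ℝ)
    (hS : Karasev.IsHJSolution U (H ∘ α) c W S) :
    -- on any interval of times on which `S` is globally defined and generates the flow
    -- of the zero section, `S` is odd
    (∀ r : ℝ, Set.Ioo (-r) r ×ˢ Set.univ ⊆ W →
      (∀ h ∈ Set.Ioo (-r) r,
        Karasev.graphDifferential (S h) = Karasev.flowOfZeroSection U (H ∘ α) h) →
      ∀ h ∈ Set.Ioo (-r) r, ∀ x, S (-h) x = -S h x) ∧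
    -- with no assumption besides the evolution equation, `S` is odd near `h = 0`
    (∃ W' ⊆ W, IsOpen W' ∧ (∀ x, (0, x) ∈ W') ∧
      ∀ h x, (h, x) ∈ W' → (-h, x) ∈ W' ∧ S (-h) x = -S h x) ∧
    -- the truncations of `S` have only odd powers of `h`
    (∀ l x, Even l → Karasev.coeff S l x = 0) ∧
    (∀ m h x, Karasev.truncation S m h x =
      ∑ l ∈ (Finset.range (m + 1)).filter Odd, Karasev.coeff S l x * h ^ l) := by
  have hsymm : ∀ z ∈ U, Karasev.reflect z ∈ U := fun z hz => hα.reflect_mem hz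
  have hG : ∀ z ∈ U, ContDiffAt ℝ ∞ (H ∘ α) z := fun z hz =>
    Karasev.contDiffAt_comp_karasev hH hα hz
  obtain ⟨D, -, hDo, hD0, hDcl, hcomm⟩ := Karasev.exists_commutation_set hπ hε hα hH
  have hodd := hS.eventually_odd hc hsymm hG hDo hD0 hcomm
  have heven : ∀ l x, Even l → Karasev.coeff S l x = 0 := fun l x hl =>
    Karasev.coeff_eq_zero_of_even
      ((Continuous.tendsto' (by fun_prop) 0 (0, x) rfl :
        Filter.Tendsto (fun t : ℝ => (t, x)) (𝓝 0) (𝓝 (0, x))).eventually (hodd x)) hl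
  refine ⟨fun r hr hex h hh x =>
    hS.odd_of_exact hc hsymm hG hDo hD0 hDcl hcomm hr hex hh x, ?_, heven,
    Karasev.truncation_eq_sum_odd heven⟩
  -- Requiring the reflected point to lie in `W` as well makes this set invariant under time
  -- reversal, and its interior inherits the invariance.
  set A : Set (ℝ × Karasev.Pt n) :=
    {q | q ∈ W ∧ Karasev.timeReflect n q ∈ W ∧ S (-q.1) q.2 = -S q.1 q.2} with hA
  have hAsymm : Karasev.timeReflect n ⁻¹' A = A := by
    ext q
    have h2 : Karasev.timeReflect n (Karasev.timeReflect n q) = q := by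
      simp [Karasev.timeReflect_apply]
    change (Karasev.timeReflect n q ∈ W ∧ Karasev.timeReflect n (Karasev.timeReflect n q) ∈ W ∧
      S (- -q.1) q.2 = -S (-q.1) q.2) ↔ (q ∈ W ∧ Karasev.timeReflect n q ∈ W ∧
      S (-q.1) q.2 = -S q.1 q.2)
    rw [h2, neg_neg, eq_neg_iff_add_eq_zero, eq_neg_iff_add_eq_zero, add_comm]
    tauto
  refine ⟨interior A, fun q hq => (interior_subset hq).1, isOpen_interior, fun x => ?_,
    fun h x hq => ⟨?_, (interior_subset hq).2.2⟩⟩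
  · rw [mem_interior_iff_mem_nhds]
    have hW : ∀ᶠ q in 𝓝 ((0 : ℝ), x), q ∈ W := hS.isOpen.mem_nhds (hS.zero_mem x)
    filter_upwards [hW, (Karasev.tendsto_timeReflect x).eventually hW, hodd x] with q h1 h2 h3
    exact ⟨h1, h2, h3⟩
  · have h1 : Karasev.timeReflect n ⁻¹' interior A ⊆ interior A := by
      conv_rhs => rw [← hAsymm]
      exact preimage_interior_subset_interior_preimage (Karasev.timeReflect n).continuous
    refine h1 ?_
    simpa [Karasev.timeReflect_apply] using hq
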